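/- Let $\boldsymbol R^3_1$ be Lorentz-Minkowski $3$-space with coordinates $(t,x,y)$ and signature $(-++)$, and let $o=(0,0)$. Let $\mathcal I^\omega_L$ be the set of germs at $o$ of real-analytic immersions of the form $F(x,y)=(f(x,y),x,y)$ into $\boldsymbol R^3_1$ with $F(o)=\boldsymbol 0$, for which $o$ is a light-like point (the induced metric on the tangent plane is degenerate), normalized by $f_x(o)=0$, $f_y(o)=1$. For such $F$ put $$B_F=1-f_x^2-f_y^2,\qquad A_F=(1-f_x^2)f_{yy}+2f_xf_yf_{xy}+(1-f_y^2)f_{xx},$$ and let $\gamma_F(x)=(f(x,0),f_y(x,0))$ be the germ at $0$ of its initial curve. The light-like point $o$ is called non-degenerate if $\nabla B_F(o)\neq 0$, and degenerate if $\nabla B_F(o)=0$. For a real-analytic function germ $\varphi$ at $o\in\boldsymbol R^2$ let $$\mathcal Y^\omega_\varphi=\{F\in\mathcal I^\omega_L : A_F-\varphi B_F^2=0\},\qquad \mathcal Z^\omega=\{F\in\mathcal I^\omega_L : A_F=0\},$$ where no restriction is put on the set of light-like points (germs with $B_F\equiv 0$ are included). Let $\mathcal C$ be the set of germs at $0$ of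 real-analytic curves $\gamma=(\gamma_1,\gamma_2):\boldsymbol R\to\boldsymbol R^2$ with $\gamma(0)=(0,1)$ and $\dot\gamma_1(0)=0$, where the dot denotes $d/dx$. **Theorem.** For every real-analytic germ $\varphi$ at $o$: 1. $\mathcal Y^\omega_\varphi$ is non-empty, and $F\mapsto\gamma_F$ is a bijection from $\mathcal Y^\omega_\varphi$ onto $\mathcal C$. 2. For $F\in\mathcal Y^\omega_\varphi$, the point $o$ is a non-degenerate light-like point if and only if $\dot\gamma_F(0)\neq(0,0)$, and a degenerate light-like point if and only if $\dot\gamma_F(0)=(0,0)$. Moreover, $F\mapsto\gamma_F$ is a bijection from $\mathcal Z^\omega$ onto $\mathcal C$. -/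

import Mathlib

open Filter Topology

namespace LightLike

/-- The parameter plane, with coordinates `(x, y)`; its origin `o` is `0`. -/
abbrev Plane : Type := ℝ × ℝ

/-- The underlying space of the Lorentz-Minkowski 3-space, with coordinates `(t, x, y)`. -/
abbrev L3 : Type := ℝ × ℝ × ℝ

/-- The Lorentzian inner product of signature `(-, +, +)`. -/
def lorentzInner (v w : L3) : ℝ :=
  -(v.1 * w.1) + v.2.1 * w.2.1 + v.2.2 * w.2.2

/-- The partial derivative `f_x`. -/
noncomputable def dX (f : Plane → ℝ) : Plane → ℝ := fun p => fderiv ℝ f p (1, 0)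

/-- The partial derivative `f_y`. -/
noncomputable def dY (f : Plane → ℝ) : Plane → ℝ := fun p => fderiv ℝ f p (0, 1)

/-- `B = 1 - f_x ^ 2 - f_y ^ 2`. -/
noncomputable def funB (f : Plane → ℝ) : Plane → ℝ := fun p =>
  1 - dX f p ^ 2 - dY f p ^ 2

/-- `A = (1 - f_x ^ 2) f_yy + 2 f_x f_y f_xy + (1 - f_y ^ 2) f_xx`. -/
noncomputable def funA (f : Plane → ℝ) : Plane → ℝ := fun p =>
  (1 - dX f p ^ 2) * dY (dY f) p + 2 * dX f p * dY f p * dY (dX f) p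
    + (1 - dY f p ^ 2) * dX (dX f) p

/-- `p` is a light-like point of `F`: the restriction of the Lorentzian inner product to the
tangent plane of `F` at `p` (the range of the differential) is degenerate. -/
def IsLightLikeAt (F : Plane → L3) (p : Plane) : Prop :=
  ∃ v ∈ LinearMap.range (fderiv ℝ F p).toLinearMap, v ≠ 0 ∧
    ∀ w ∈ LinearMap.range (fderiv ℝ F p).toLinearMap, lorentzInner v w = 0

/-- The `t`-component of `F`; for a graph `F = (f(x, y), x, y)` it is the function `f`. -/
def height (F : Plane → L3) : Plane → ℝ := fun p => (F p).1

/-- `F` represents a germ of a real analytic immersion mapping `o` to the origin, having `o` as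
a light-like point, of the graph form `F = (f(x, y), x, y)` near `o`, and normalized by
`f_x(o) = 0`, `f_y(o) = 1`. -/
structure IsNormalized (F : Plane → L3) : Prop where
  analytic : AnalyticAt ℝ F 0
  map_zero : F 0 = 0
  immersion : Function.Injective (fderiv ℝ F 0)
  lightLike : IsLightLikeAt F 0
  graph : ∀ᶠ p in 𝓝 (0 : Plane), F p = (height F p, p.1, p.2)
  normX : dX (height F) 0 = 0
  normY : dY (height F) 0 = 1

/-- Germs at `o` of real analytic functions of `(x, y)`. -/
def analyticFunctionGerms : Set (Germ (𝓝 (0 : Plane)) ℝ) :=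
  {g | ∃ u : Plane → ℝ, AnalyticAt ℝ u 0 ∧ (u : Germ (𝓝 (0 : Plane)) ℝ) = g}

/-- The set of normalized real analytic surface germs satisfying `A - φ B ^ 2 = 0`
(an identity of germs at `o`). -/
def admissibleGerms (φ : Germ (𝓝 (0 : Plane)) ℝ) : Set (Germ (𝓝 (0 : Plane)) L3) :=
  {G | ∃ F : Plane → L3, IsNormalized F ∧ (F : Germ (𝓝 (0 : Plane)) L3) = G ∧
    (funA (height F) : Germ (𝓝 (0 : Plane)) ℝ)
      - φ * (funB (height F) : Germ (𝓝 (0 : Plane)) ℝ) ^ 2 = 0}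

/-- The set of normalized real analytic surface germs of zero mean curvature, `A = 0`. -/
def zmcGerms : Set (Germ (𝓝 (0 : Plane)) L3) :=
  {G | ∃ F : Plane → L3, IsNormalized F ∧ (F : Germ (𝓝 (0 : Plane)) L3) = G ∧
    (funA (height F) : Germ (𝓝 (0 : Plane)) ℝ) = 0}

/-- The initial curve `x ↦ (f(x, 0), f_y(x, 0))`. -/
noncomputable def initialCurve (F : Plane → L3) : ℝ → ℝ × ℝ := fun x =>
  (height F (x, 0), dY (height F) (x, 0))

theorem initialCurve_congr {F G : Plane → L3} (h : F =ᶠ[𝓝 (0 : Plane)] G) :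
    initialCurve F =ᶠ[𝓝 (0 : ℝ)] initialCurve G := by
  have h1 : height F =ᶠ[𝓝 (0 : Plane)] height G := by
    filter_upwards [h] with p hp
    simp only [height, hp]
  have h2 : dY (height F) =ᶠ[𝓝 (0 : Plane)] dY (height G) := by
    filter_upwards [h1.fderiv (𝕜 := ℝ)] with p hp
    simp only [dY, hp]
  have ht : Tendsto (fun x : ℝ => ((x, 0) : Plane)) (𝓝 0) (𝓝 0) := by
    have hc : Continuous (fun x : ℝ => ((x, 0) : Plane)) := by fun_prop
    exact hc.tendsto' 0 0 rfl
  filter_upwards [ht.eventually h1, ht.eventually h2] with x hx1 hx2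
  simp only [initialCurve, hx1, hx2]

/-- The map sending a surface germ to the germ at `0` of its initial curve. -/
noncomputable def initialCurveGerm :
    Germ (𝓝 (0 : Plane)) L3 → Germ (𝓝 (0 : ℝ)) (ℝ × ℝ) :=
  Germ.map' initialCurve fun _ _ h => initialCurve_congr h

/-- Germs at `0` of real analytic plane curves `γ = (γ₁, γ₂)` with `γ(0) = (0, 1)` and
`γ₁'(0) = 0`. The last condition is the normalization `f_x(o) = 0` for an initial curve. -/
def initialCurveGerms : Set (Germ (𝓝 (0 : ℝ)) (ℝ × ℝ)) :=
  {c | ∃ γ : ℝ → ℝ × ℝ, AnalyticAt ℝ γ 0 ∧ γ 0 = (0, 1) ∧ (deriv γ 0).1 = 0 ∧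
    (γ : Germ (𝓝 (0 : ℝ)) (ℝ × ℝ)) = c}

/-- The gradient of `B` at the base point `o`. -/
noncomputable def gradB (F : Plane → L3) : ℝ × ℝ :=
  (dX (funB (height F)) 0, dY (funB (height F)) 0)

/-- `o` is a non-degenerate light-like point: it is light-like and the gradient of `B` does not
vanish there. -/
def IsNondegenerateLightLike (F : Plane → L3) : Prop :=
  IsLightLikeAt F 0 ∧ gradB F ≠ (0, 0)

/-- `o` is a degenerate light-like point: it is light-like and the gradient of `B` vanishes
there. -/
def IsDegenerateLightLike (F : Plane → L3) : Prop :=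
  IsLightLikeAt F 0 ∧ gradB F = (0, 0)

end LightLike

/-!
# The Cauchy problem for `A = φ B ^ 2` at a light-like point

The equation is solved for `f_yy`. A formal solution is found by iteration, each step gaining one
order of vanishing. Its convergence follows from a submultiplicative weighted `ℓ¹` norm on double
power series, for which the operator `∂_y⁻¹ ∂_x` is bounded by a small constant.
-/

/-! At `o` the coefficient `1 - f_x ^ 2` of `f_yy` is `1`, so the `x`-axis is non-characteristic
even though `o` is light-like, and the statement is a Cauchy-Kovalevskaya theorem with data `f(x,
0)`, `f_y(x, 0)`, that is, the initial curve.

Put `G = f_yy`. The data and two integrations in `y` recover `f` from `G`, and the equation becomes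
the fixed point equation `G = f_x ^ 2 G - 2 f_x f_y f_xy - (1 - f_y ^ 2) f_xx + φ B ^ 2`. The
normalization makes `f_x` and `1 - f_y ^ 2` vanish at `o`, so every second derivative on the right
has a coefficient vanishing there, while `B` contains only first derivatives. Changing `G` in order
`n` therefore changes the right side in order `n + 1` (`cauchyMap_contracting`): there is exactly
one formal solution, which gives injectivity.

For convergence, the weight `r ^ j * s ^ k / (j + k).choose j` makes the `ℓ¹` norm submultiplicative
and bounds `∂_y⁻¹ ∂_x` by `s / r` without loss of radius. Since `f_xy` and `f_xx` involve `G` only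
through one or two applications of this operator, for `s` small against `r` a ball is mapped into
itself (`norm_cauchyMap_le`), and the formal solution lies in it. `Represents` transfers all this
between series and analytic germs.

Finally, at `o` the equation reduces to `f_yy = 0`, so `∇B = (-2 f_xy, 0)`, while the initial curve
has velocity `(0, f_xy)`. Zero mean curvature is the case `φ = 0`. -/

namespace LightLike

open scoped NNReal ENNReal

/-! ### Formal double power series and their calculus. -/

section DoubleSeries

open Finset PowerSeries

/-- Formal power series in `x` and `y`, as power series in `y` over power series in `x`. -/
abbrev Series : Type := PowerSeries (PowerSeries ℝ)

/-- The componentwise antidiagonal on pairs of natural numbers. -/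
instance natProdAntidiagonal : HasAntidiagonal (ℕ × ℕ) where
  antidiagonal m := (antidiagonal m.1 ×ˢ antidiagonal m.2).map
    (Equiv.prodProdProdComm ℕ ℕ ℕ ℕ).toEmbedding
  mem_antidiagonal {n a} := by
    obtain ⟨⟨a, b⟩, c, d⟩ := a
    simp [Finset.mem_map_equiv, Prod.ext_iff]

namespace Series

/-- The coefficient of `x ^ m.1 * y ^ m.2`. -/
noncomputable def c (m : ℕ × ℕ) : Series →+ ℝ :=
  ((coeff (R := ℝ) m.1).toAddMonoidHom).comp (coeff (R := PowerSeries ℝ) m.2).toAddMonoidHom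

theorem c_apply (m : ℕ × ℕ) (F : Series) : c m F = coeff m.1 (coeff m.2 F) := rfl

/-- The series with given coefficients. -/
noncomputable def ofCoeff (a : ℕ × ℕ → ℝ) : Series :=
  PowerSeries.mk fun k => PowerSeries.mk fun j => a (j, k)

@[simp] theorem c_ofCoeff (a : ℕ × ℕ → ℝ) (m : ℕ × ℕ) : c m (ofCoeff a) = a m := by
  simp [c_apply, ofCoeff]

theorem ext_c {F G : Series} (h : ∀ m, c m F = c m G) : F = G := by
  ext k j
  exact h (j, k)

theorem c_one (m : ℕ × ℕ) : c m 1 = if m = 0 then 1 else 0 := by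
  obtain ⟨j, k⟩ := m
  rw [c_apply, coeff_one]
  by_cases hk : k = 0
  · subst hk
    simp [coeff_one, Prod.ext_iff]
  · simp [hk, Prod.ext_iff]

/-- The nested Cauchy product is flattened into one sum over the antidiagonal of `ℕ × ℕ`, the shape
needed to compare with products of sums over all exponents. -/
theorem c_mul (m : ℕ × ℕ) (F G : Series) :
    c m (F * G) = ∑ p ∈ antidiagonal m, c p.1 F * c p.2 G := by
  change _ = ∑ p ∈ (antidiagonal m.1 ×ˢ antidiagonal m.2).map
    (Equiv.prodProdProdComm ℕ ℕ ℕ ℕ).toEmbedding, c p.1 F * c p.2 G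
  rw [Finset.sum_map, Finset.sum_product_right, c_apply, coeff_mul, map_sum]
  refine Finset.sum_congr rfl fun k _ => ?_
  rw [coeff_mul]
  rfl

/-- The variable `y`. -/
noncomputable abbrev Y : Series := PowerSeries.X

@[simp] theorem c_Y_mul_zero (j : ℕ) (F : Series) : c (j, 0) (Y * F) = 0 := by
  simp [c_apply]

@[simp] theorem c_Y_mul_succ (j k : ℕ) (F : Series) : c (j, k + 1) (Y * F) = c (j, k) F := by
  simp [c_apply, coeff_succ_X_mul]

/-- The formal partial derivative with respect to `x`. -/
noncomputable def derivX (F : Series) : Series :=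
  ofCoeff fun m => (m.1 + 1) * c (m.1 + 1, m.2) F

/-- The formal partial derivative with respect to `y`. -/
noncomputable def derivY (F : Series) : Series :=
  ofCoeff fun m => (m.2 + 1) * c (m.1, m.2 + 1) F

/-- The formal primitive with respect to `y` without terms constant in `y`. -/
noncomputable def primY (F : Series) : Series :=
  ofCoeff fun m => (m.2 : ℝ)⁻¹ * c (m.1, m.2 - 1) F

/-- The part of a series which is constant in `y`. -/
noncomputable def restrictX (F : Series) : Series :=
  ofCoeff fun m => if m.2 = 0 then c (m.1, 0) F else 0

@[simp] theorem c_derivX (m : ℕ × ℕ) (F : Series) :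
    c m (derivX F) = (m.1 + 1) * c (m.1 + 1, m.2) F := by
  simp [derivX]

@[simp] theorem c_derivY (m : ℕ × ℕ) (F : Series) :
    c m (derivY F) = (m.2 + 1) * c (m.1, m.2 + 1) F := by
  simp [derivY]

@[simp] theorem c_primY_zero (j : ℕ) (F : Series) : c (j, 0) (primY F) = 0 := by
  simp [primY]

@[simp] theorem c_primY_succ (j k : ℕ) (F : Series) :
    c (j, k + 1) (primY F) = ((k : ℝ) + 1)⁻¹ * c (j, k) F := by
  simp [primY]

@[simp] theorem c_restrictX (m : ℕ × ℕ) (F : Series) :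
    c m (restrictX F) = if m.2 = 0 then c (m.1, 0) F else 0 := by
  simp [restrictX]

theorem derivX_sub (F G : Series) : derivX (F - G) = derivX F - derivX G :=
  ext_c fun m => by simp; ring

theorem derivX_add (F G : Series) : derivX (F + G) = derivX F + derivX G :=
  ext_c fun m => by simp; ring

theorem derivY_add (F G : Series) : derivY (F + G) = derivY F + derivY G :=
  ext_c fun m => by simp; ring

theorem primY_sub (F G : Series) : primY (F - G) = primY F - primY G :=
  ext_c fun m => by
    obtain ⟨j, _ | k⟩ := m
    · simp
    · simp; ring

theorem derivY_primY (F : Series) : derivY (primY F) = F :=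
  ext_c fun m => by
    have : (m.2 : ℝ) + 1 ≠ 0 := by positivity
    simp [this]

theorem derivX_primY (F : Series) : derivX (primY F) = primY (derivX F) :=
  ext_c fun m => by
    obtain ⟨j, _ | k⟩ := m
    · simp
    · simp; ring

theorem derivX_Y_mul (F : Series) : derivX (Y * F) = Y * derivX F :=
  ext_c fun m => by
    obtain ⟨j, _ | k⟩ := m
    · simp
    · simp

theorem derivY_restrictX (F : Series) : derivY (restrictX F) = 0 :=
  ext_c fun m => by simp

theorem derivY_Y_mul_restrictX (F : Series) : derivY (Y * restrictX F) = restrictX F :=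
  ext_c fun m => by
    obtain ⟨j, _ | k⟩ := m
    · simp
    · simp

theorem derivX_restrictX (F : Series) : derivX (restrictX F) = restrictX (derivX F) :=
  ext_c fun m => by
    obtain ⟨j, _ | k⟩ := m
    · simp
    · simp

theorem restrictX_add (F G : Series) : restrictX (F + G) = restrictX F + restrictX G :=
  ext_c fun m => by
    obtain ⟨j, _ | k⟩ := m
    · simp
    · simp

@[simp] theorem restrictX_restrictX (F : Series) : restrictX (restrictX F) = restrictX F :=
  ext_c fun m => by
    obtain ⟨j, _ | k⟩ := m
    · simp
    · simp

@[simp] theorem restrictX_Y_mul (F : Series) : restrictX (Y * F) = 0 :=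
  ext_c fun m => by
    obtain ⟨j, _ | k⟩ := m
    · simp
    · simp

@[simp] theorem restrictX_primY (F : Series) : restrictX (primY F) = 0 :=
  ext_c fun m => by
    obtain ⟨j, _ | k⟩ := m
    · simp
    · simp

theorem restrictX_add_primY_derivY (F : Series) : restrictX F + primY (derivY F) = F :=
  ext_c fun m => by
    obtain ⟨j, _ | k⟩ := m
    · simp
    · have : (k : ℝ) + 1 ≠ 0 := by positivity
      simp [this]

theorem primY_restrictX (F : Series) : primY (restrictX F) = Y * restrictX F :=
  ext_c fun m => by
    obtain ⟨j, _ | _ | k⟩ := m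
    · simp
    · simp
    · simp

theorem primY_add (F G : Series) : primY (F + G) = primY F + primY G :=
  ext_c fun m => by
    obtain ⟨j, _ | k⟩ := m
    · simp
    · simp; ring

/-! ### Order of vanishing -/

/-- All coefficients of total degree less than `n` vanish. -/
def VanishesTo (n : ℕ) (F : Series) : Prop := ∀ m : ℕ × ℕ, m.1 + m.2 < n → c m F = 0

namespace VanishesTo

variable {n n' : ℕ} {F G : Series}

theorem add (hF : VanishesTo n F) (hG : VanishesTo n G) : VanishesTo n (F + G) := fun m hm => by
  rw [map_add, hF m hm, hG m hm, add_zero]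

theorem sub (hF : VanishesTo n F) (hG : VanishesTo n G) : VanishesTo n (F - G) := fun m hm => by
  rw [map_sub, hF m hm, hG m hm, sub_zero]

theorem mono (hF : VanishesTo n F) (h : n' ≤ n) : VanishesTo n' F := fun m hm =>
  hF m (hm.trans_le h)

theorem mul (hF : VanishesTo n F) (hG : VanishesTo n' G) : VanishesTo (n + n') (F * G) := by
  intro m hm
  rw [c_mul]
  refine Finset.sum_eq_zero fun p hp => ?_
  have hp' := mem_antidiagonal.1 hp
  have h1 : p.1.1 + p.2.1 = m.1 := by rw [← hp']; rfl
  have h2 : p.1.2 + p.2.2 = m.2 := by rw [← hp']; rfl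
  rcases lt_or_ge (p.1.1 + p.1.2) n with h | h
  · rw [hF _ h, zero_mul]
  · rw [hG p.2 (by omega), mul_zero]

theorem zero_order (F : Series) : VanishesTo 0 F := fun m hm => by omega

theorem mul_right (hF : VanishesTo n F) (G : Series) : VanishesTo n (F * G) :=
  hF.mul (zero_order G)

theorem mul_left (hF : VanishesTo n F) (G : Series) : VanishesTo n (G * F) := by
  simpa [mul_comm] using hF.mul_right G

theorem primY (hF : VanishesTo n F) : VanishesTo (n + 1) (primY F) := by
  rintro ⟨j, _ | k⟩ hm
  · simp
  · rw [c_primY_succ, hF _ (by simp at hm ⊢; omega), mul_zero]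

theorem derivX (hF : VanishesTo (n + 1) F) : VanishesTo n (derivX F) := by
  intro m hm
  rw [c_derivX, hF _ (by simp; omega), mul_zero]

theorem eq_zero (h : ∀ n, VanishesTo n F) : F = 0 :=
  ext_c fun m => by simpa using h (m.1 + m.2 + 1) m (by omega)

theorem Y_mul (F : Series) : VanishesTo 1 (Y * F) := by
  rintro ⟨j, _ | k⟩ hm
  · simp
  · simp at hm

end VanishesTo

theorem vanishesTo_one_iff {F : Series} : VanishesTo 1 F ↔ c (0, 0) F = 0 := by
  refine ⟨fun h => h _ (by simp), fun h => ?_⟩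
  rintro ⟨j, k⟩ hm
  obtain ⟨rfl, rfl⟩ : j = 0 ∧ k = 0 := by simp at hm; omega
  exact h

/-! ### A weighted norm -/

/-- The weight of the monomial `x ^ m.1 * y ^ m.2`. -/
noncomputable def weight (r s : ℝ≥0) (m : ℕ × ℕ) : ℝ≥0 :=
  r ^ m.1 * s ^ m.2 / (m.1 + m.2).choose m.1

/-- The product of the two binomials is a single term of Vandermonde's sum for the binomial of `m +
n`; dividing reverses the inequality. -/
theorem weight_add_le (r s : ℝ≥0) (m n : ℕ × ℕ) :
    weight r s (m + n) ≤ weight r s m * weight r s n := by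
  have hm : 0 < ((m.1 + m.2).choose m.1) := Nat.choose_pos (by omega)
  have hn : 0 < ((n.1 + n.2).choose n.1) := Nat.choose_pos (by omega)
  have h : (m.1 + m.2).choose m.1 * (n.1 + n.2).choose n.1 ≤
      (m.1 + n.1 + (m.2 + n.2)).choose (m.1 + n.1) := by
    have : m.1 + n.1 + (m.2 + n.2) = (m.1 + m.2) + (n.1 + n.2) := by ring
    rw [this, Nat.add_choose_eq (m.1 + m.2) (n.1 + n.2)]
    exact Finset.single_le_sum
      (f := fun ij : ℕ × ℕ => (m.1 + m.2).choose ij.1 * (n.1 + n.2).choose ij.2)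
      (fun _ _ => Nat.zero_le _) (a := (m.1, n.1)) (mem_antidiagonal.2 rfl)
  unfold weight
  rw [div_mul_div_comm, Prod.fst_add, Prod.snd_add]
  have e : r ^ (m.1 + n.1) * s ^ (m.2 + n.2) = r ^ m.1 * s ^ m.2 * (r ^ n.1 * s ^ n.2) := by ring
  rw [e]
  gcongr
  exact_mod_cast h

/-- A weighted `ℓ¹` norm of a formal power series. -/
noncomputable def norm (r s : ℝ≥0) (F : Series) : ℝ≥0∞ :=
  ∑' m, ((‖c m F‖₊ * weight r s m : ℝ≥0) : ℝ≥0∞)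

variable {r s : ℝ≥0}

theorem norm_add_le (F G : Series) : norm r s (F + G) ≤ norm r s F + norm r s G := by
  unfold norm
  rw [← ENNReal.tsum_add]
  refine ENNReal.tsum_le_tsum fun m => ?_
  rw [← ENNReal.coe_add, ENNReal.coe_le_coe, ← add_mul, map_add]
  gcongr
  exact nnnorm_add_le _ _

theorem norm_neg (F : Series) : norm r s (-F) = norm r s F := by
  simp [norm]

theorem norm_sub_le (F G : Series) : norm r s (F - G) ≤ norm r s F + norm r s G := by
  rw [sub_eq_add_neg, ← norm_neg G]
  exact norm_add_le _ _

theorem norm_mul_le (F G : Series) : norm r s (F * G) ≤ norm r s F * norm r s G := by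
  have h : norm r s F * norm r s G = ∑' m, ∑ p ∈ antidiagonal m,
      ((‖c p.1 F‖₊ * weight r s p.1 * (‖c p.2 G‖₊ * weight r s p.2) : ℝ≥0) : ℝ≥0∞) := by
    unfold norm
    simp_rw [← ENNReal.tsum_mul_right, ← ENNReal.tsum_mul_left]
    rw [← ENNReal.tsum_prod (f := fun a b => ((‖c a F‖₊ * weight r s a : ℝ≥0) : ℝ≥0∞) *
      ((‖c b G‖₊ * weight r s b : ℝ≥0) : ℝ≥0∞)),
      ← Finset.HasAntidiagonal.sigmaAntidiagonalEquivProd.tsum_eq, ENNReal.tsum_sigma']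
    refine tsum_congr fun m => ?_
    rw [tsum_fintype, Finset.univ_eq_attach,
      ← Finset.sum_attach (antidiagonal m)]
    simp
  rw [h]
  refine ENNReal.tsum_le_tsum fun m => ?_
  rw [← ENNReal.ofNNReal_finsetSum, ENNReal.coe_le_coe, c_mul]
  calc ‖∑ p ∈ antidiagonal m, c p.1 F * c p.2 G‖₊ * weight r s m
      ≤ (∑ p ∈ antidiagonal m, ‖c p.1 F‖₊ * ‖c p.2 G‖₊) * weight r s m := by
        gcongr
        refine (nnnorm_sum_le _ _).trans_eq ?_
        simp
    _ ≤ _ := by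
        rw [Finset.sum_mul]
        refine Finset.sum_le_sum fun p hp => ?_
        rw [← mem_antidiagonal.1 hp]
        calc _ ≤ ‖c p.1 F‖₊ * ‖c p.2 G‖₊ * (weight r s p.1 * weight r s p.2) := by
              gcongr
              exact weight_add_le _ _ _ _
          _ = _ := by ring

theorem norm_one : norm r s 1 = 1 := by
  rw [norm, tsum_eq_single 0]
  · simp [c_one, weight]
  · intro m hm
    simp [c_one, hm]

theorem tsum_natProd_eq (f : ℕ × ℕ → ℝ≥0∞) :
    ∑' m, f m = ∑' j, f (j, 0) + ∑' m : ℕ × ℕ, f (m.1, m.2 + 1) := by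
  rw [ENNReal.tsum_prod', ENNReal.tsum_prod' (f := fun m : ℕ × ℕ => f (m.1, m.2 + 1)),
    ← ENNReal.tsum_add]
  refine tsum_congr fun j => ?_
  exact tsum_eq_zero_add' ENNReal.summable

theorem weight_succ_right_le (j k : ℕ) :
    weight r s (j, k + 1) ≤ s * weight r s (j, k) := by
  have h : 0 < (j + k).choose j := Nat.choose_pos (by omega)
  have h' : (j + k).choose j ≤ (j + (k + 1)).choose j := Nat.choose_le_choose _ (by omega)
  unfold weight
  rw [← mul_div_assoc, show r ^ j * s ^ (k + 1) = s * (r ^ j * s ^ k) by ring]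
  dsimp only
  gcongr

theorem norm_Y_mul_le (F : Series) : norm r s (Y * F) ≤ s * norm r s F := by
  rw [norm, tsum_natProd_eq, norm, ← ENNReal.tsum_mul_left]
  simp only [c_Y_mul_zero, nnnorm_zero, zero_mul, ENNReal.coe_zero, tsum_zero, zero_add,
    c_Y_mul_succ]
  refine ENNReal.tsum_le_tsum fun m => ?_
  rw [← ENNReal.coe_mul, ENNReal.coe_le_coe]
  calc _ ≤ ‖c m F‖₊ * (s * weight r s m) := by
        gcongr
        exact weight_succ_right_le _ _
    _ = _ := by ring

theorem norm_primY_le (F : Series) : norm r s (primY F) ≤ s * norm r s F := by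
  rw [norm, tsum_natProd_eq, norm, ← ENNReal.tsum_mul_left]
  simp only [c_primY_zero, nnnorm_zero, zero_mul, ENNReal.coe_zero, tsum_zero, zero_add,
    c_primY_succ]
  refine ENNReal.tsum_le_tsum fun m => ?_
  rw [← ENNReal.coe_mul, ENNReal.coe_le_coe]
  have h1 : ‖((m.2 : ℝ) + 1)⁻¹‖₊ ≤ 1 := by
    rw [← NNReal.coe_le_coe, coe_nnnorm, Real.norm_of_nonneg (by positivity)]
    exact inv_le_one_of_one_le₀ (by simp)
  calc _ ≤ 1 * ‖c m F‖₊ * (s * weight r s m) := by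
        rw [nnnorm_mul]
        gcongr
        exact weight_succ_right_le _ _
    _ = _ := by ring

/-- This is what the binomial in the weight is for: its ratio along a diagonal of constant total
degree cancels the factor `(j + 1) / (k + 1)` produced by `∂_y⁻¹ ∂_x`. -/
theorem weight_diagonal (hr : r ≠ 0) (j k : ℕ) :
    (k + 1 : ℝ≥0)⁻¹ * (j + 1) * weight r s (j, k + 1) = s / r * weight r s (j + 1, k) := by
  have h : (j + (k + 1)).choose j * (k + 1) = (j + 1 + k).choose (j + 1) * (j + 1) := by
    have := Nat.choose_succ_right_eq (j + (k + 1)) j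
    rw [show j + 1 + k = j + (k + 1) by ring, this]
    congr 1
    omega
  have h' : ((j + (k + 1)).choose j : ℝ≥0) * (k + 1) =
      (j + 1 + k).choose (j + 1) * (j + 1) := by exact_mod_cast h
  have h1 : ((j + (k + 1)).choose j : ℝ≥0) ≠ 0 := by
    exact_mod_cast (Nat.choose_pos (by omega)).ne'
  have h2 : ((j + 1 + k).choose (j + 1) : ℝ≥0) ≠ 0 := by
    exact_mod_cast (Nat.choose_pos (by omega)).ne'
  have h3 : (k + 1 : ℝ≥0) ≠ 0 := by positivity
  simp only [weight]
  field_simp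
  calc _ = r * r ^ j * s ^ (k + 1) * (((j + 1 + k).choose (j + 1) : ℝ≥0) * (j + 1)) := by ring
    _ = _ := by rw [← h']; ring

theorem norm_primY_derivX_le (hr : r ≠ 0) (F : Series) :
    norm r s (primY (derivX F)) ≤ (s / r : ℝ≥0) * norm r s F := by
  rw [norm, tsum_natProd_eq]
  simp only [c_primY_zero, nnnorm_zero, zero_mul, ENNReal.coe_zero, tsum_zero, zero_add,
    c_primY_succ, c_derivX]
  have hi : Function.Injective fun m : ℕ × ℕ => (m.1 + 1, m.2) := by
    rintro ⟨a, b⟩ ⟨c, d⟩ h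
    simpa using h
  refine le_trans ?_ (mul_le_mul_right (ENNReal.tsum_comp_le_tsum_of_injective hi
    fun m => ((‖c m F‖₊ * weight r s m : ℝ≥0) : ℝ≥0∞)) _)
  rw [← ENNReal.tsum_mul_left]
  refine ENNReal.tsum_le_tsum fun m => ?_
  rw [← ENNReal.coe_mul, ENNReal.coe_le_coe]
  have e1 : ‖((m.2 : ℝ) + 1)⁻¹‖₊ = ((m.2 : ℝ≥0) + 1)⁻¹ := by
    ext
    rw [coe_nnnorm, Real.norm_of_nonneg (by positivity)]
    simp
  have e2 : ‖((m.1 : ℝ) + 1)‖₊ = ((m.1 : ℝ≥0) + 1) := by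
    ext
    rw [coe_nnnorm, Real.norm_of_nonneg (by positivity)]
    simp
  rw [nnnorm_mul, nnnorm_mul, e1, e2]
  apply le_of_eq
  calc _ = ‖c (m.1 + 1, m.2) F‖₊ *
      ((m.2 + 1 : ℝ≥0)⁻¹ * (m.1 + 1) * weight r s (m.1, m.2 + 1)) := by ring
    _ = _ := by rw [weight_diagonal hr]; ring

theorem norm_mono {r' s' : ℝ≥0} (hr : r ≤ r') (hs : s ≤ s') (F : Series) :
    norm r s F ≤ norm r' s' F := by
  refine ENNReal.tsum_le_tsum fun m => ?_
  rw [ENNReal.coe_le_coe]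
  unfold weight
  gcongr

/-- Only monomials of degree at least one occur, and each loses a factor `t` or more. It makes the
initial `f_x` small by shrinking the radius. -/
theorem norm_smul_le_of_vanishesTo_one {F : Series} (hF : VanishesTo 1 F) {t : ℝ≥0} (ht : t ≤ 1) :
    norm (t * r) (t * s) F ≤ t * norm r s F := by
  unfold norm
  rw [← ENNReal.tsum_mul_left]
  refine ENNReal.tsum_le_tsum fun m => ?_
  rw [← ENNReal.coe_mul, ENNReal.coe_le_coe]
  rcases Nat.eq_zero_or_pos (m.1 + m.2) with h | h
  · simp [hF m (by omega)]
  · have e : weight (t * r) (t * s) m = t ^ (m.1 + m.2) * weight r s m := by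
      unfold weight
      rw [mul_pow, mul_pow, pow_add]
      ring
    rw [e]
    calc _ = t ^ (m.1 + m.2) * (‖c m F‖₊ * weight r s m) := by ring
      _ ≤ _ := by
        gcongr
        exact pow_le_of_le_one zero_le ht h.ne'

/-! ### Fixed points of maps that raise the order of vanishing. -/

theorem eq_of_contracting {Φ : Series → Series}
    (hΦ : ∀ n F G, VanishesTo n (F - G) → VanishesTo (n + 1) (Φ F - Φ G)) {F G : Series}
    (hF : Φ F = F) (hG : Φ G = G) : F = G := by
  refine sub_eq_zero.1 (VanishesTo.eq_zero fun n => ?_)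
  induction n with
  | zero => exact VanishesTo.zero_order _
  | succ n ih => simpa only [hF, hG] using hΦ n F G ih

/-- Coefficients of the iterates stabilize degree by degree, so no contraction in norm is needed.
The bound passes to the limit because each finite partial sum of its norm is already a partial sum
for one iterate. -/
theorem exists_fixedPoint {Φ : Series → Series}
    (hΦ : ∀ n F G, VanishesTo n (F - G) → VanishesTo (n + 1) (Φ F - Φ G)) {M : ℝ≥0∞}
    (hM : ∀ F, norm r s F ≤ M → norm r s (Φ F) ≤ M) :
    ∃ G, Φ G = G ∧ norm r s G ≤ M := by
  let u : ℕ → Series := fun n => Φ^[n] 0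
  have hu : ∀ n, u (n + 1) = Φ (u n) := fun n => Function.iterate_succ_apply' Φ n 0
  have h1 : ∀ n, VanishesTo n (u (n + 1) - u n) := by
    intro n
    induction n with
    | zero => exact VanishesTo.zero_order _
    | succ n ih => simpa only [hu] using hΦ n _ _ ih
  have h2 : ∀ n k, VanishesTo n (u (n + k) - u n) := by
    intro n k
    induction k with
    | zero => intro m _; simp
    | succ k ih =>
      have := ((h1 (n + k)).mono (Nat.le_add_right n k)).add ih
      simpa [add_assoc] using this
  -- The `n`-th iterate is final only in degrees strictly below `n`, hence the `+ 1`.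
  let G : Series := ofCoeff fun m => c m (u (m.1 + m.2 + 1))
  have hG : ∀ n (m : ℕ × ℕ), m.1 + m.2 < n → c m G = c m (u n) := by
    intro n m hm
    obtain ⟨k, rfl⟩ := Nat.exists_eq_add_of_le (Nat.succ_le_of_lt hm)
    have := h2 (m.1 + m.2 + 1) k m (by omega)
    rw [map_sub, sub_eq_zero] at this
    simp only [G, c_ofCoeff]
    exact this.symm
  have hGV : ∀ n, VanishesTo n (G - u n) := fun n m hm => by
    rw [map_sub, hG n m hm, sub_self]
  refine ⟨G, sub_eq_zero.1 (VanishesTo.eq_zero fun n => ?_), ?_⟩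
  -- Both `Φ G` and `G` agree with `u (n + 1)` in degrees below `n + 1`.
  · have := (hΦ n _ _ (hGV n)).sub (hGV (n + 1))
    rw [← hu, sub_sub_sub_cancel_right] at this
    exact this.mono n.le_succ
  · have hb : ∀ n, norm r s (u n) ≤ M := by
      intro n
      induction n with
      | zero => simp [u, norm]
      | succ n ih => rw [hu]; exact hM _ ih
    rw [norm, ENNReal.tsum_eq_iSup_sum]
    refine iSup_le fun t => ?_
    have : ∀ m ∈ t, c m G = c m (u (t.sup (fun m => m.1 + m.2) + 1)) := fun m hm =>
      hG _ m (Nat.lt_succ_of_le (Finset.le_sup (f := fun m : ℕ × ℕ => m.1 + m.2) hm))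
    rw [Finset.sum_congr rfl fun m hm => by rw [this m hm]]
    exact (ENNReal.sum_le_tsum t).trans (hb _)

/-! ### The formal Cauchy problem. -/

/-- The series with second `y`-derivative `G` and Cauchy data `U₁`, `U₂` on the `x`-axis. -/
noncomputable def ofCauchyData (U₁ U₂ G : Series) : Series := U₁ + Y * U₂ + primY (primY G)

section CauchyData

variable {U₁ U₂ : Series}

theorem derivX_ofCauchyData (G : Series) :
    derivX (ofCauchyData U₁ U₂ G) =
      derivX U₁ + Y * derivX U₂ + primY (primY (derivX G)) := by
  simp only [ofCauchyData, derivX_add, derivX_Y_mul, derivX_primY]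

/-- Each `derivX` acting on `G` is paired with its own `primY`, so that `norm_primY_derivX_le`
applies twice and no unbounded operator remains on `G`. -/
theorem derivX_derivX_ofCauchyData (G : Series) :
    derivX (derivX (ofCauchyData U₁ U₂ G)) = derivX (derivX U₁) + Y * derivX (derivX U₂) +
      primY (derivX (primY (derivX G))) := by
  simp only [derivX_ofCauchyData, derivX_add, derivX_Y_mul, derivX_primY]

theorem derivY_ofCauchyData (h₁ : restrictX U₁ = U₁) (h₂ : restrictX U₂ = U₂) (G : Series) :
    derivY (ofCauchyData U₁ U₂ G) = U₂ + primY G := by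
  rw [ofCauchyData, derivY_add, derivY_add, derivY_primY, ← h₁, ← h₂, derivY_restrictX,
    derivY_Y_mul_restrictX, zero_add]

theorem derivY_derivX_ofCauchyData (h₁ : restrictX U₁ = U₁) (h₂ : restrictX U₂ = U₂)
    (G : Series) :
    derivY (derivX (ofCauchyData U₁ U₂ G)) = derivX U₂ + primY (derivX G) := by
  rw [derivX_ofCauchyData, derivY_add, derivY_add, derivY_primY, ← h₁, ← h₂, derivX_restrictX,
    derivX_restrictX, derivY_restrictX, derivY_Y_mul_restrictX, zero_add]

theorem derivY_derivY_ofCauchyData (h₁ : restrictX U₁ = U₁) (h₂ : restrictX U₂ = U₂)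
    (G : Series) : derivY (derivY (ofCauchyData U₁ U₂ G)) = G := by
  rw [derivY_ofCauchyData h₁ h₂, derivY_add, derivY_primY, ← h₂, derivY_restrictX, zero_add]

theorem restrictX_ofCauchyData (h₁ : restrictX U₁ = U₁) (G : Series) :
    restrictX (ofCauchyData U₁ U₂ G) = U₁ := by
  simp [ofCauchyData, restrictX_add, h₁]

theorem restrictX_derivY_ofCauchyData (h₁ : restrictX U₁ = U₁) (h₂ : restrictX U₂ = U₂)
    (G : Series) : restrictX (derivY (ofCauchyData U₁ U₂ G)) = U₂ := by
  simp [derivY_ofCauchyData h₁ h₂, restrictX_add, h₂]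

end CauchyData

/-- The fundamental theorem of calculus in `y`, used twice. It reduces uniqueness to uniqueness of
the fixed point. -/
theorem ofCauchyData_derivY_derivY (F : Series) :
    ofCauchyData (restrictX F) (restrictX (derivY F)) (derivY (derivY F)) = F := by
  rw [ofCauchyData, ← primY_restrictX, add_assoc, ← primY_add, restrictX_add_primY_derivY,
    restrictX_add_primY_derivY]

/-- The formal version of `A`. -/
noncomputable def formalA (F : Series) : Series :=
  (1 - derivX F ^ 2) * derivY (derivY F) + 2 * derivX F * derivY F * derivY (derivX F)
    + (1 - derivY F ^ 2) * derivX (derivX F)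

/-- The formal version of `B`. -/
noncomputable def formalB (F : Series) : Series := 1 - derivX F ^ 2 - derivY F ^ 2

/-- The map whose fixed points are the second `y`-derivatives of the formal solutions of
`A = φ B ^ 2` with Cauchy data `U₁`, `U₂`. -/
noncomputable def cauchyMap (φ U₁ U₂ G : Series) : Series :=
  derivX (ofCauchyData U₁ U₂ G) ^ 2 * G
    - 2 * derivX (ofCauchyData U₁ U₂ G) * derivY (ofCauchyData U₁ U₂ G) *
      derivY (derivX (ofCauchyData U₁ U₂ G))
    - (1 - derivY (ofCauchyData U₁ U₂ G) ^ 2) * derivX (derivX (ofCauchyData U₁ U₂ G))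
    + φ * formalB (ofCauchyData U₁ U₂ G) ^ 2

section Solve

variable {φ U₁ U₂ : Series}

theorem cauchyMap_eq_self_iff (h₁ : restrictX U₁ = U₁) (h₂ : restrictX U₂ = U₂) (G : Series) :
    cauchyMap φ U₁ U₂ G = G ↔
      formalA (ofCauchyData U₁ U₂ G) - φ * formalB (ofCauchyData U₁ U₂ G) ^ 2 = 0 := by
  rw [formalA, derivY_derivY_ofCauchyData h₁ h₂, ← sub_eq_zero, ← neg_eq_zero, cauchyMap]
  ring_nf

theorem cauchyMap_contracting (h₁ : restrictX U₁ = U₁) (h₂ : restrictX U₂ = U₂)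
    (hU₁ : VanishesTo 1 (derivX U₁)) (hU₂ : VanishesTo 1 (1 - U₂)) (n : ℕ) (G H : Series)
    (h : VanishesTo n (G - H)) :
    VanishesTo (n + 1) (cauchyMap φ U₁ U₂ G - cauchyMap φ U₁ U₂ H) := by
  have hp0 : ∀ G, VanishesTo 1 (derivX (ofCauchyData U₁ U₂ G)) := fun G => by
    rw [derivX_ofCauchyData]
    exact (hU₁.add (VanishesTo.Y_mul _)).add (VanishesTo.zero_order _).primY
  have hq0 : VanishesTo 1 (1 - derivY (ofCauchyData U₁ U₂ G) ^ 2) := by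
    rw [derivY_ofCauchyData h₁ h₂]
    have : 1 - (U₂ + primY G) ^ 2 = (1 - U₂ - primY G) * (1 + U₂ + primY G) := by ring
    rw [this]
    exact (hU₂.sub (VanishesTo.zero_order _).primY).mul_right _
  have hp : VanishesTo (n + 1)
      (derivX (ofCauchyData U₁ U₂ G) - derivX (ofCauchyData U₁ U₂ H)) := by
    -- The primitives are moved inside the derivative so that the order is raised before
    -- `VanishesTo.derivX` lowers it; otherwise `n = 0` would be lost.
    rw [derivX_ofCauchyData, derivX_ofCauchyData, add_sub_add_left_eq_sub, ← primY_sub,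
      ← primY_sub, ← derivX_sub, ← derivX_primY, ← derivX_primY]
    exact h.primY.primY.derivX
  have hq : VanishesTo (n + 1)
      (derivY (ofCauchyData U₁ U₂ G) - derivY (ofCauchyData U₁ U₂ H)) := by
    rw [derivY_ofCauchyData h₁ h₂, derivY_ofCauchyData h₁ h₂, add_sub_add_left_eq_sub,
      ← primY_sub]
    exact h.primY
  have hxy : VanishesTo n (derivY (derivX (ofCauchyData U₁ U₂ G)) -
      derivY (derivX (ofCauchyData U₁ U₂ H))) := by
    rw [derivY_derivX_ofCauchyData h₁ h₂, derivY_derivX_ofCauchyData h₁ h₂,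
      add_sub_add_left_eq_sub, ← primY_sub, ← derivX_sub, ← derivX_primY]
    exact h.primY.derivX
  have hxx : VanishesTo n (derivX (derivX (ofCauchyData U₁ U₂ G)) -
      derivX (derivX (ofCauchyData U₁ U₂ H))) := by
    rw [derivX_derivX_ofCauchyData, derivX_derivX_ofCauchyData,
      add_sub_add_left_eq_sub, ← primY_sub, ← derivX_sub, ← primY_sub, ← derivX_sub,
      ← derivX_primY, ← derivX_primY, ← derivX_primY]
    exact h.primY.primY.derivX.derivX
  have hpG := hp0 G
  have hpp : VanishesTo (n + 1) (derivX (ofCauchyData U₁ U₂ G) ^ 2 * (G - H)) := by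
    rw [pow_two, add_comm, mul_assoc]
    exact hpG.mul (h.mul_left _)
  have hpxy := hpG.mul hxy
  have hqxx := hq0.mul hxx
  rw [add_comm] at hpxy hqxx
  unfold cauchyMap formalB
  generalize derivY (derivX (ofCauchyData U₁ U₂ G)) = v at *
  generalize derivY (derivX (ofCauchyData U₁ U₂ H)) = v' at *
  generalize derivX (derivX (ofCauchyData U₁ U₂ G)) = w at *
  generalize derivX (derivX (ofCauchyData U₁ U₂ H)) = w' at *
  generalize derivX (ofCauchyData U₁ U₂ G) = p at *
  generalize derivX (ofCauchyData U₁ U₂ H) = p' at *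
  generalize derivY (ofCauchyData U₁ U₂ G) = q at *
  generalize derivY (ofCauchyData U₁ U₂ H) = q' at *
  -- Telescoping: differences of second derivatives gain their order from the coefficients `p ^ 2`,
  -- `p`, `1 - q ^ 2`; everything else is a multiple of `p - p'` or `q - q'`.
  have key := ((((hpp.sub (hpxy.mul_left (2 * q))).sub hqxx).add
    (hp.mul_left ((p + p') * H - 2 * q * v' - φ * (p + p') *
      ((1 - p ^ 2 - q ^ 2) + (1 - p' ^ 2 - q' ^ 2))))).add
    (hq.mul_left ((q + q') * w' - 2 * p' * v' - φ * (q + q') *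
      ((1 - p ^ 2 - q ^ 2) + (1 - p' ^ 2 - q' ^ 2)))))
  convert key using 1
  ring

theorem exists_pos_le_of_continuous {b : ℝ≥0 → ℝ≥0} (hb : Continuous b) {M : ℝ≥0}
    (h0 : b 0 < M) {r : ℝ≥0} (hr : 0 < r) : ∃ s, 0 < s ∧ s ≤ r ∧ b s ≤ M := by
  have h1 : ∀ᶠ s in 𝓝[>] (0 : ℝ≥0), b s < M :=
    (hb.tendsto 0).mono_left nhdsWithin_le_nhds |>.eventually_lt_const h0
  have h2 : ∀ᶠ s in 𝓝[>] (0 : ℝ≥0), s ≤ r :=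
    nhdsWithin_le_nhds (Iic_mem_nhds hr)
  obtain ⟨s, ⟨h, h'⟩, h''⟩ := ((h1.and h2).and self_mem_nhdsWithin).exists
  exact ⟨s, h'', h', h.le⟩

/-- An upper bound for the norm of `cauchyMap φ U₁ U₂ G` in terms of bounds for the norms
of the derivatives of the data. -/
theorem norm_cauchyMap_le (h₁ : restrictX U₁ = U₁) (h₂ : restrictX U₂ = U₂) {t K M : ℝ≥0}
    (hr : r ≠ 0) (hφ : norm r s φ ≤ K) (hp : norm r s (derivX U₁) ≤ t)
    (hpp : norm r s (derivX (derivX U₁)) ≤ K) (hq : norm r s U₂ ≤ K)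
    (hqx : norm r s (derivX U₂) ≤ K) (hqxx : norm r s (derivX (derivX U₂)) ≤ K)
    {G : Series} (hG : norm r s G ≤ M) :
    norm r s (cauchyMap φ U₁ U₂ G) ≤
      (((t + s * K + s * (s / r * M)) ^ 2 * M
        + (1 + 1) * (t + s * K + s * (s / r * M)) * (K + s * M) * (K + s / r * M)
        + (1 + (K + s * M) ^ 2) * (K + s * K + s / r * (s / r * M))
        + K * (1 + (t + s * K + s * (s / r * M)) ^ 2 + (K + s * M) ^ 2) ^ 2 : ℝ≥0) : ℝ≥0∞) := by
  have hadd : ∀ {F G : Series} {a b : ℝ≥0}, norm r s F ≤ a → norm r s G ≤ b →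
      norm r s (F + G) ≤ (a + b : ℝ≥0) := fun hF hG => by
    rw [ENNReal.coe_add]
    exact (norm_add_le _ _).trans (add_le_add hF hG)
  have hsub : ∀ {F G : Series} {a b : ℝ≥0}, norm r s F ≤ a → norm r s G ≤ b →
      norm r s (F - G) ≤ (a + b : ℝ≥0) := fun hF hG => by
    rw [ENNReal.coe_add]
    exact (norm_sub_le _ _).trans (add_le_add hF hG)
  have hmul : ∀ {F G : Series} {a b : ℝ≥0}, norm r s F ≤ a → norm r s G ≤ b →
      norm r s (F * G) ≤ (a * b : ℝ≥0) := fun hF hG => by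
    rw [ENNReal.coe_mul]
    exact (norm_mul_le _ _).trans (mul_le_mul' hF hG)
  have hsq : ∀ {F : Series} {a : ℝ≥0}, norm r s F ≤ a → norm r s (F ^ 2) ≤ (a ^ 2 : ℝ≥0) :=
    fun hF => by rw [pow_two, pow_two]; exact hmul hF hF
  have hone : norm r s 1 ≤ (1 : ℝ≥0) := norm_one.le
  have hY : ∀ {F : Series} {a : ℝ≥0}, norm r s F ≤ a → norm r s (Y * F) ≤ (s * a : ℝ≥0) :=
    fun hF => by
      rw [ENNReal.coe_mul]
      exact (norm_Y_mul_le _).trans (mul_le_mul' le_rfl hF)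
  have hI : ∀ {F : Series} {a : ℝ≥0}, norm r s F ≤ a → norm r s (primY F) ≤ (s * a : ℝ≥0) :=
    fun hF => by
      rw [ENNReal.coe_mul]
      exact (norm_primY_le _).trans (mul_le_mul' le_rfl hF)
  have hD : ∀ {F : Series} {a : ℝ≥0}, norm r s F ≤ a →
      norm r s (primY (derivX F)) ≤ (s / r * a : ℝ≥0) := fun hF => by
    rw [ENNReal.coe_mul]
    exact (norm_primY_derivX_le hr _).trans (mul_le_mul' le_rfl hF)
  have e2 : (2 : Series) = 1 + 1 := by norm_num
  rw [cauchyMap, formalB, derivX_derivX_ofCauchyData, derivY_derivX_ofCauchyData h₁ h₂,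
    derivX_ofCauchyData, derivY_ofCauchyData h₁ h₂, e2]
  -- Bounds for `f_x`, `f_y`, `f_xy`, `f_xx`, in this order.
  have bp := hadd (hadd hp (hY hqx)) (hI (hD hG))
  have bq := hadd hq (hI hG)
  have bxy := hadd hqx (hD hG)
  have bxx := hadd (hadd hpp (hY hqxx)) (hD (hD hG))
  exact hadd (hsub (hsub (hmul (hsq bp) hG) (hmul (hmul (hmul (hadd hone hone) bp) bq) bxy))
    (hmul (hsub hone (hsq bq)) bxx)) (hmul hφ (hsq (hsub (hsub hone (hsq bp)) (hsq bq))))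

/-- The formal Cauchy problem for `A = φ B ^ 2` has a convergent solution. -/
theorem exists_convergent_solution (h₁ : restrictX U₁ = U₁) (h₂ : restrictX U₂ = U₂)
    (hU₁ : VanishesTo 1 (derivX U₁)) (hU₂ : VanishesTo 1 (1 - U₂)) {ρ K : ℝ≥0} (hρ : 0 < ρ)
    (hφ : norm ρ ρ φ ≤ K) (hu : norm ρ ρ U₁ ≤ K) (hp : norm ρ ρ (derivX U₁) ≤ K)
    (hpp : norm ρ ρ (derivX (derivX U₁)) ≤ K) (hq : norm ρ ρ U₂ ≤ K)
    (hqx : norm ρ ρ (derivX U₂) ≤ K) (hqxx : norm ρ ρ (derivX (derivX U₂)) ≤ K) :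
    ∃ F : Series, restrictX F = U₁ ∧ restrictX (derivY F) = U₂ ∧
      formalA F - φ * formalB F ^ 2 = 0 ∧
      ∃ r s : ℝ≥0, 0 < r ∧ 0 < s ∧ norm r s F < ⊤ := by
  -- This choice gives `t * K ≤ 1 / 2`, so that at `s = 0` the term `f_x ^ 2 G` costs at most `M /
  -- 4`.
  set t : ℝ≥0 := (2 * K + 1)⁻¹ with ht
  have ht1 : t ≤ 1 := inv_le_one_of_one_le₀ (by simp)
  have ht0 : 0 < t := by positivity
  have htK : t * K ≤ 1 / 2 := by
    rw [ht, inv_mul_le_iff₀ (by positivity)]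
    have : (2 * K + 1) * (1 / 2) = K + 1 / 2 := by
      rw [add_mul, mul_comm 2 K, mul_assoc]; norm_num
    rw [this]
    exact le_self_add
  set r : ℝ≥0 := t * ρ with hr
  have hr0 : 0 < r := mul_pos ht0 hρ
  have hrρ : r ≤ ρ := mul_le_of_le_one_left zero_le ht1
  -- At `s = 0` the bound of `norm_cauchyMap_le` is `(t * K) ^ 2 * M + C`, and `M = 2 * C + 1`
  -- strictly exceeds `M / 4 + C`. With `r` fixed, continuity in `s` then provides a positive `s`.
  set C : ℝ≥0 := (1 + 1) * (t * K) * K * K + (1 + K ^ 2) * K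
    + K * (1 + (t * K) ^ 2 + K ^ 2) ^ 2 with hC
  set M : ℝ≥0 := 2 * C + 1 with hM
  obtain ⟨s, hs0, hsr, hs⟩ := exists_pos_le_of_continuous (M := M) (r := r)
    (b := fun s => (t * K + s * K + s * (s / r * M)) ^ 2 * M
        + (1 + 1) * (t * K + s * K + s * (s / r * M)) * (K + s * M) * (K + s / r * M)
        + (1 + (K + s * M) ^ 2) * (K + s * K + s / r * (s / r * M))
        + K * (1 + (t * K + s * K + s * (s / r * M)) ^ 2 + (K + s * M) ^ 2) ^ 2)
    (by simp only [div_eq_mul_inv]; fun_prop) (by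
      have e : (t * K) ^ 2 * M + C < M := by
        have h4 : (t * K) ^ 2 ≤ (1 / 2) ^ 2 := by gcongr
        calc (t * K) ^ 2 * M + C ≤ (1 / 2) ^ 2 * M + C := by gcongr
          _ < M := by
            rw [hM, ← NNReal.coe_lt_coe]
            push_cast
            have := C.coe_nonneg
            nlinarith
      refine lt_of_le_of_lt (le_of_eq ?_) e
      rw [hC]
      simp only [zero_mul, zero_div, add_zero]
      ring) hr0
  have hmono : ∀ {F : Series}, norm ρ ρ F ≤ K → norm r s F ≤ K := fun h =>
    (norm_mono hrρ (hsr.trans hrρ) _).trans h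
  have hp' : norm r s (derivX U₁) ≤ (t * K : ℝ≥0) := by
    rw [ENNReal.coe_mul]
    exact (norm_mono le_rfl hsr _).trans
      ((norm_smul_le_of_vanishesTo_one hU₁ ht1).trans (mul_le_mul' le_rfl hp))
  obtain ⟨G, hG, hGM⟩ := exists_fixedPoint (r := r) (s := s) (M := M)
    (cauchyMap_contracting (φ := φ) h₁ h₂ hU₁ hU₂) fun G hG =>
      (norm_cauchyMap_le h₁ h₂ hr0.ne' (hmono hφ) hp' (hmono hpp) (hmono hq) (hmono hqx)
        (hmono hqxx) hG).trans (ENNReal.coe_le_coe.2 hs)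
  refine ⟨ofCauchyData U₁ U₂ G, restrictX_ofCauchyData h₁ G,
    restrictX_derivY_ofCauchyData h₁ h₂ G, (cauchyMap_eq_self_iff h₁ h₂ G).1 hG, r, s, hr0, hs0,
    ?_⟩
  have f1 : norm r s U₁ < ⊤ := (hmono hu).trans_lt ENNReal.coe_lt_top
  have f2 : norm r s (Y * U₂) < ⊤ := (norm_Y_mul_le _).trans_lt
    (ENNReal.mul_lt_top ENNReal.coe_lt_top ((hmono hq).trans_lt ENNReal.coe_lt_top))
  have f3 : norm r s (primY (primY G)) < ⊤ := (norm_primY_le _).trans_lt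
    (ENNReal.mul_lt_top ENNReal.coe_lt_top ((norm_primY_le _).trans_lt
      (ENNReal.mul_lt_top ENNReal.coe_lt_top (hGM.trans_lt ENNReal.coe_lt_top))))
  exact (norm_add_le _ _).trans_lt
    (ENNReal.add_lt_top.2 ⟨(norm_add_le _ _).trans_lt (ENNReal.add_lt_top.2 ⟨f1, f2⟩), f3⟩)

/-- Solutions of the formal Cauchy problem for `A = φ B ^ 2` are unique. -/
theorem eq_of_formal_solution {F F' : Series} (hX : c (1, 0) F = 0) (hY : c (0, 1) F = 1)
    (h : restrictX F = restrictX F') (h' : restrictX (derivY F) = restrictX (derivY F'))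
    (hF : formalA F - φ * formalB F ^ 2 = 0) (hF' : formalA F' - φ * formalB F' ^ 2 = 0) :
    F = F' := by
  have hc := cauchyMap_contracting (φ := φ) (restrictX_restrictX F)
    (restrictX_restrictX (derivY F)) (vanishesTo_one_iff.2 (by simp [hX]))
    (vanishesTo_one_iff.2 (by simp [c_one, hY]))
  -- With equal Cauchy data, both second derivatives are fixed points of the same map.
  have key : derivY (derivY F) = derivY (derivY F') := by
    refine eq_of_contracting hc ?_ ?_
    · rw [cauchyMap_eq_self_iff (by simp) (by simp), ofCauchyData_derivY_derivY]
      exact hF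
    · rw [cauchyMap_eq_self_iff (by simp) (by simp), h, h', ofCauchyData_derivY_derivY]
      exact hF'
  rw [← ofCauchyData_derivY_derivY F, ← ofCauchyData_derivY_derivY F', h, h', key]

end Solve
-- Convergent double series as functions.
-- The general index serves two purposes: `ℕ × ℕ` for products of series, `ℕ` for grouping monomials
-- by total degree.
theorem summable_sum_antidiagonal {A : Type*} [AddMonoid A] [HasAntidiagonal A]
    {u : A × A → ℝ} (hu : Summable u) :
    Summable fun n => ∑ m ∈ antidiagonal n, u m := by
  refine ((Finset.HasAntidiagonal.sigmaAntidiagonalEquivProd.summable_iff.2 hu).sigma).congr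
    fun n => ?_
  rw [tsum_fintype, Finset.univ_eq_attach, ← Finset.sum_attach (antidiagonal n)]
  rfl

theorem hasSum_sum_antidiagonal {A : Type*} [AddMonoid A] [HasAntidiagonal A]
    {u : A × A → ℝ} {a : ℝ} (hu : HasSum u a) :
    HasSum (fun n => ∑ m ∈ antidiagonal n, u m) a := by
  refine (Finset.HasAntidiagonal.sigmaAntidiagonalEquivProd.hasSum_iff.2 hu).sigma fun n => ?_
  have := hasSum_fintype fun m : antidiagonal n => u m
  rw [Finset.univ_eq_attach, Finset.sum_attach (antidiagonal n) u] at this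
  exact this

/-- The series converges absolutely on the closed polydisc of radius `ρ`. -/
def ConvergesOn (F : Series) (ρ : ℝ) : Prop :=
  Summable fun m : ℕ × ℕ => |c m F| * ρ ^ (m.1 + m.2)

/-- The value of the term of index `m` at the point `p`. -/
noncomputable def term (F : Series) (p : Plane) (m : ℕ × ℕ) : ℝ :=
  c m F * p.1 ^ m.1 * p.2 ^ m.2

theorem abs_term_le {F : Series} {p : Plane} {ρ : ℝ} (hp : ‖p‖ ≤ ρ) (m : ℕ × ℕ) :
    |term F p m| ≤ |c m F| * ρ ^ (m.1 + m.2) := by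
  have h0 : 0 ≤ ρ := (norm_nonneg p).trans hp
  have h1 : |p.1| ≤ ρ := (norm_fst_le p).trans hp
  have h2 : |p.2| ≤ ρ := (norm_snd_le p).trans hp
  rw [term, abs_mul, abs_mul, abs_pow, abs_pow, pow_add, mul_assoc]
  gcongr

namespace ConvergesOn

variable {F G : Series} {ρ : ℝ}

theorem summable_norm_term (h : ConvergesOn F ρ) {p : Plane} (hp : ‖p‖ ≤ ρ) :
    Summable fun m => ‖term F p m‖ :=
  Summable.of_nonneg_of_le (fun _ => norm_nonneg _) (abs_term_le hp) h

theorem summable_term (h : ConvergesOn F ρ) {p : Plane} (hp : ‖p‖ ≤ ρ) : Summable (term F p) :=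
  (h.summable_norm_term hp).of_norm

theorem mono (h : ConvergesOn F ρ) {ρ' : ℝ} (h0 : 0 ≤ ρ') (hρ : ρ' ≤ ρ) : ConvergesOn F ρ' :=
  Summable.of_nonneg_of_le (fun _ => by positivity) (fun _ => by gcongr) h

theorem add (hρ : 0 ≤ ρ) (hF : ConvergesOn F ρ) (hG : ConvergesOn G ρ) :
    ConvergesOn (F + G) ρ :=
  Summable.of_nonneg_of_le (fun _ => by positivity) (fun m => by
    rw [← add_mul, map_add]
    gcongr
    exact abs_add_le _ _) (Summable.add hF hG)

theorem neg (hF : ConvergesOn F ρ) : ConvergesOn (-F) ρ :=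
  Summable.congr hF fun m => by rw [map_neg, abs_neg]

theorem mul (hρ : 0 ≤ ρ) (hF : ConvergesOn F ρ) (hG : ConvergesOn G ρ) :
    ConvergesOn (F * G) ρ := by
  have h := summable_sum_antidiagonal (Summable.mul_of_nonneg hF hG
    (fun _ => by positivity) (fun _ => by positivity))
  refine Summable.of_nonneg_of_le (fun _ => by positivity) (fun m => ?_) h
  rw [c_mul]
  refine (mul_le_mul_of_nonneg_right (abs_sum_le_sum_abs _ _) (by positivity)).trans ?_
  rw [Finset.sum_mul]
  refine Finset.sum_le_sum fun p hp => le_of_eq ?_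
  rw [← mem_antidiagonal.1 hp, abs_mul, Prod.fst_add, Prod.snd_add]
  ring

end ConvergesOn

theorem hasSum_term_mul {F G : Series} {p : Plane} {a b : ℝ} (hF : HasSum (term F p) a)
    (hG : HasSum (term G p) b) (hF' : Summable fun m => ‖term F p m‖)
    (hG' : Summable fun m => ‖term G p m‖) : HasSum (term (F * G) p) (a * b) := by
  refine (hasSum_sum_antidiagonal (hF.mul hG (summable_mul_of_summable_norm hF' hG'))).congr_fun
    fun m => ?_
  rw [term, c_mul, Finset.sum_mul, Finset.sum_mul]
  refine Finset.sum_congr rfl fun q hq => ?_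
  rw [← mem_antidiagonal.1 hq, term, term, Prod.fst_add, Prod.snd_add]
  ring

/-- The function `f` is the sum of the formal power series `F` near the origin. -/
def Represents (F : Series) (f : Plane → ℝ) : Prop :=
  ∃ ρ : ℝ, 0 < ρ ∧ ConvergesOn F ρ ∧ ∀ᶠ p in 𝓝 (0 : Plane), HasSum (term F p) (f p)

theorem eventually_norm_le {ρ : ℝ} (hρ : 0 < ρ) : ∀ᶠ p in 𝓝 (0 : Plane), ‖p‖ ≤ ρ := by
  filter_upwards [Metric.closedBall_mem_nhds (0 : Plane) hρ] with p hp
  simpa using hp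

theorem ConvergesOn.represents {F : Series} {ρ : ℝ} (h : ConvergesOn F ρ) (hρ : 0 < ρ) :
    Represents F fun p => ∑' m, term F p m :=
  ⟨ρ, hρ, h, (eventually_norm_le hρ).mono fun _ hp => (h.summable_term hp).hasSum⟩

namespace Represents

variable {F G : Series} {f g : Plane → ℝ}

theorem congr (h : Represents F f) (hfg : f =ᶠ[𝓝 0] g) : Represents F g := by
  obtain ⟨ρ, hρ, hF, hs⟩ := h
  refine ⟨ρ, hρ, hF, ?_⟩
  filter_upwards [hs, hfg] with p hp hp'
  rwa [← hp']

theorem eventuallyEq (hf : Represents F f) (hg : Represents F g) : f =ᶠ[𝓝 0] g := by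
  obtain ⟨_, _, _, hf⟩ := hf
  obtain ⟨_, _, _, hg⟩ := hg
  filter_upwards [hf, hg] with p h1 h2
  exact h1.unique h2

theorem add (hf : Represents F f) (hg : Represents G g) : Represents (F + G) (f + g) := by
  obtain ⟨ρ, hρ, hF, hf⟩ := hf
  obtain ⟨ρ', hρ', hG, hg⟩ := hg
  have h0 := lt_min hρ hρ'
  refine ⟨min ρ ρ', h0, (hF.mono h0.le (min_le_left _ _)).add h0.le
    (hG.mono h0.le (min_le_right _ _)), ?_⟩
  filter_upwards [hf, hg] with p h1 h2
  refine (h1.add h2).congr_fun fun m => ?_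
  simp only [term, map_add]
  ring

theorem neg (hf : Represents F f) : Represents (-F) (-f) := by
  obtain ⟨ρ, hρ, hF, hf⟩ := hf
  refine ⟨ρ, hρ, hF.neg, ?_⟩
  filter_upwards [hf] with p h1
  refine h1.neg.congr_fun fun m => ?_
  simp [term]

theorem sub (hf : Represents F f) (hg : Represents G g) : Represents (F - G) (f - g) := by
  rw [sub_eq_add_neg, sub_eq_add_neg]
  exact hf.add hg.neg

theorem mul (hf : Represents F f) (hg : Represents G g) : Represents (F * G) (f * g) := by
  obtain ⟨ρ, hρ, hF, hf⟩ := hf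
  obtain ⟨ρ', hρ', hG, hg⟩ := hg
  have h0 := lt_min hρ hρ'
  have hF := hF.mono h0.le (min_le_left _ ρ')
  have hG := hG.mono h0.le (min_le_right ρ _)
  refine ⟨min ρ ρ', h0, hF.mul h0.le hG, ?_⟩
  filter_upwards [hf, hg, eventually_norm_le h0] with p h1 h2 hp
  exact hasSum_term_mul h1 h2 (hF.summable_norm_term hp) (hG.summable_norm_term hp)

theorem pow_two (hf : Represents F f) : Represents (F ^ 2) (f ^ 2) := by
  rw [sq, sq]
  exact hf.mul hf

theorem one : Represents 1 1 := by
  refine ⟨1, one_pos, ?_, Eventually.of_forall fun p => ?_⟩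
  · refine summable_of_ne_finset_zero (s := {0}) fun m hm => ?_
    simp only [Finset.mem_singleton] at hm
    simp [c_one, hm]
  · have := hasSum_single (f := term 1 p) 0 fun m hm => by simp [term, c_one, hm]
    simpa [term, c_one] using this

theorem zero : Represents 0 0 :=
  ⟨1, one_pos, by simp [ConvergesOn, summable_zero], Eventually.of_forall fun p => by
    have : term 0 p = fun _ => 0 := by ext; simp [term]
    rw [this]
    exact hasSum_zero⟩

theorem apply_zero (hf : Represents F f) : f 0 = c (0, 0) F := by
  obtain ⟨ρ, hρ, hF, hf⟩ := hf
  refine hf.self_of_nhds.unique ?_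
  have := hasSum_single (f := term F 0) (0, 0) (by
    rintro ⟨j, k⟩ hm
    rcases Nat.eq_zero_or_pos j with rfl | hj
    · have hk : k ≠ 0 := by rintro rfl; exact hm rfl
      simp [term, hk]
    · simp [term, hj.ne'])
  simpa [term] using this

theorem restrictX (hf : Represents F f) :
    Represents (restrictX F) fun p => f (p.1, 0) := by
  obtain ⟨ρ, hρ, hF, hf⟩ := hf
  refine ⟨ρ, hρ, Summable.of_nonneg_of_le (fun _ => by positivity) (fun m => ?_) hF, ?_⟩
  · refine mul_le_mul_of_nonneg_right ?_ (by positivity)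
    obtain ⟨j, _ | k⟩ := m
    · simp
    · simp
  · have ht : Tendsto (fun p : Plane => ((p.1, 0) : Plane)) (𝓝 0) (𝓝 0) := by
      have hc : Continuous (fun p : Plane => ((p.1, 0) : Plane)) := by fun_prop
      exact hc.tendsto' 0 0 rfl
    filter_upwards [ht.eventually hf] with p hp
    refine hp.congr_fun fun m => ?_
    obtain ⟨j, _ | k⟩ := m
    · simp [term]
    · simp [term]

end Represents

theorem hasSum_apply {u : ℕ × ℕ → Plane →L[ℝ] ℝ} (hu : Summable u) (v : Plane) :
    HasSum (fun m => u m v) ((∑' m, u m) v) := by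
  exact hu.hasSum.mapL (ContinuousLinearMap.apply ℝ ℝ v)

/-- The derivative of the term of index `m`. -/
noncomputable def termDeriv (F : Series) (p : Plane) (m : ℕ × ℕ) : Plane →L[ℝ] ℝ :=
  (c m F * (m.1 * p.1 ^ (m.1 - 1)) * p.2 ^ m.2) • ContinuousLinearMap.fst ℝ ℝ ℝ +
  (c m F * p.1 ^ m.1 * (m.2 * p.2 ^ (m.2 - 1))) • ContinuousLinearMap.snd ℝ ℝ ℝ

theorem hasFDerivAt_term (F : Series) (p : Plane) (m : ℕ × ℕ) :
    HasFDerivAt (fun q => term F q m) (termDeriv F p m) p := by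
  have h1 : HasFDerivAt (fun q : Plane => q.1) (ContinuousLinearMap.fst ℝ ℝ ℝ) p :=
    hasFDerivAt_fst
  have h2 : HasFDerivAt (fun q : Plane => q.2) (ContinuousLinearMap.snd ℝ ℝ ℝ) p :=
    hasFDerivAt_snd
  refine (((h1.pow m.1).const_mul (c m F)).mul (h2.pow m.2)).congr_fderiv ?_
  ext
  · simp [termDeriv]
    ring
  · simp [termDeriv]

/-- Halving the radius absorbs the factor `j` from differentiation, as `j + 1 ≤ 2 ^ j`. -/
theorem natCast_mul_pow_pred_le {ρ a : ℝ} (hρ : 0 < ρ) (ha : |a| ≤ ρ / 2) (j : ℕ) :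
    |j * a ^ (j - 1)| ≤ 2 / ρ * ρ ^ j := by
  rcases j with _ | j
  · simp; positivity
  · have h : ((j + 1 : ℕ) : ℝ) ≤ 2 ^ j := by exact_mod_cast Nat.lt_two_pow_self
    rw [abs_mul, abs_pow, Nat.abs_cast, Nat.add_sub_cancel]
    calc ((j + 1 : ℕ) : ℝ) * |a| ^ j ≤ 2 ^ j * (ρ / 2) ^ j := by gcongr
      _ = ρ ^ j := by rw [← mul_pow]; congr 1; ring
      _ ≤ 2 * ρ ^ j := by nlinarith [pow_pos hρ j]
      _ = 2 / ρ * ρ ^ (j + 1) := by rw [pow_succ]; field_simp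

theorem norm_termDeriv_le (F : Series) {p : Plane} {ρ : ℝ} (hρ : 0 < ρ) (hp : ‖p‖ ≤ ρ / 2)
    (m : ℕ × ℕ) : ‖termDeriv F p m‖ ≤ 4 / ρ * (|c m F| * ρ ^ (m.1 + m.2)) := by
  have h1 : |p.1| ≤ ρ / 2 := (norm_fst_le p).trans hp
  have h2 : |p.2| ≤ ρ / 2 := (norm_snd_le p).trans hp
  have h1' : |p.1| ≤ ρ := by linarith
  have h2' : |p.2| ≤ ρ := by linarith
  refine (_root_.norm_add_le _ _).trans ?_
  have e1 : |c m F * (m.1 * p.1 ^ (m.1 - 1)) * p.2 ^ m.2| =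
      |c m F| * |m.1 * p.1 ^ (m.1 - 1)| * |p.2| ^ m.2 := by
    rw [abs_mul, abs_mul (c m F), abs_pow]
  have e2 : |c m F * p.1 ^ m.1 * (m.2 * p.2 ^ (m.2 - 1))| =
      |c m F| * |p.1| ^ m.1 * |m.2 * p.2 ^ (m.2 - 1)| := by
    rw [abs_mul, abs_mul (c m F), abs_pow]
  rw [norm_smul, norm_smul, Real.norm_eq_abs, Real.norm_eq_abs, e1, e2]
  calc _ ≤ |c m F| * (2 / ρ * ρ ^ m.1) * ρ ^ m.2 * 1 +
        |c m F| * ρ ^ m.1 * (2 / ρ * ρ ^ m.2) * 1 := by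
        gcongr
        · exact natCast_mul_pow_pred_le hρ h1 _
        · exact ContinuousLinearMap.norm_fst_le _ _ _
        · exact natCast_mul_pow_pred_le hρ h2 _
        · exact ContinuousLinearMap.norm_snd_le _ _ _
    _ = _ := by rw [pow_add]; ring

namespace Represents

variable {F G : Series} {f g : Plane → ℝ}

theorem eventually_hasFDerivAt (hf : Represents F f) :
    ∀ᶠ p in 𝓝 (0 : Plane), Summable (termDeriv F p) ∧
      HasFDerivAt f (∑' m, termDeriv F p m) p := by
  obtain ⟨ρ, hρ, hF, hf⟩ := hf
  have hb : Metric.ball (0 : Plane) (ρ / 2) ∈ 𝓝 (0 : Plane) := Metric.ball_mem_nhds _ (by positivity)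
  filter_upwards [hf.eventually_nhds, hb] with p hp hpb
  have hle : ∀ q ∈ Metric.ball (0 : Plane) (ρ / 2), ‖q‖ ≤ ρ / 2 := fun q hq => by
    exact (mem_ball_zero_iff.1 hq).le
  have hu : Summable fun m : ℕ × ℕ => 4 / ρ * (|c m F| * ρ ^ (m.1 + m.2)) := hF.mul_left _
  refine ⟨Summable.of_norm_bounded hu fun m => norm_termDeriv_le F hρ (hle p hpb) m, ?_⟩
  have h := hasFDerivAt_tsum_of_isPreconnected (f := fun m q => term F q m)
    (f' := fun m q => termDeriv F q m) hu Metric.isOpen_ball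
    (convex_ball (0 : Plane) (ρ / 2)).isPreconnected
    (fun m q _ => hasFDerivAt_term F q m)
    (fun m q hq => norm_termDeriv_le F hρ (hle q hq) m) hpb
    (hF.summable_term ((hle p hpb).trans (by linarith))) hpb
  refine h.congr_of_eventuallyEq ?_
  filter_upwards [hp] with q hq
  exact hq.tsum_eq.symm

theorem dX (hf : Represents F f) : Represents (derivX F) (dX f) := by
  have hd := hf.eventually_hasFDerivAt
  obtain ⟨ρ, hρ, hF, -⟩ := hf
  have hi : Function.Injective fun m : ℕ × ℕ => (m.1 + 1, m.2) := by
    rintro ⟨a, b⟩ ⟨c, d⟩ h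
    simpa using h
  refine ⟨ρ / 2, by positivity, ?_, ?_⟩
  · refine Summable.of_nonneg_of_le (fun _ => by positivity) (fun m => ?_)
      ((hF.comp_injective hi).mul_left (2 / ρ))
    have := natCast_mul_pow_pred_le hρ (a := ρ / 2) (by rw [abs_of_pos (by positivity)]) (m.1 + 1)
    have h2 : (ρ / 2) ^ m.2 ≤ ρ ^ m.2 := by gcongr; linarith
    rw [abs_of_nonneg (by positivity), Nat.add_sub_cancel] at this
    rw [c_derivX, abs_mul, abs_of_nonneg (by positivity : (0 : ℝ) ≤ m.1 + 1), pow_add]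
    calc _ = |c (m.1 + 1, m.2) F| * (((m.1 + 1 : ℕ) : ℝ) * (ρ / 2) ^ m.1) * (ρ / 2) ^ m.2 := by
          push_cast; ring
      _ ≤ |c (m.1 + 1, m.2) F| * (2 / ρ * ρ ^ (m.1 + 1)) * ρ ^ m.2 := by gcongr
      _ = _ := by simp only [Function.comp]; ring
  · filter_upwards [hd] with p hp
    have h : HasSum (fun m => termDeriv F p m (1, 0)) (LightLike.dX f p) := by
      rw [LightLike.dX, hp.2.fderiv]
      exact hasSum_apply hp.1 (1, 0)
    -- Monomials without `x` have zero `x`-derivative, so the sum may be reindexed by the shifted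
    -- exponents.
    rw [← hi.hasSum_iff] at h
    · refine h.congr_fun fun m => ?_
      simp [term, termDeriv]
      left
      ring
    · rintro ⟨_ | j, k⟩ hm
      · simp [termDeriv]
      · exact absurd ⟨(j, k), rfl⟩ hm

theorem dY (hf : Represents F f) : Represents (derivY F) (dY f) := by
  have hd := hf.eventually_hasFDerivAt
  obtain ⟨ρ, hρ, hF, -⟩ := hf
  have hi : Function.Injective fun m : ℕ × ℕ => (m.1, m.2 + 1) := by
    rintro ⟨a, b⟩ ⟨c, d⟩ h
    simpa using h
  refine ⟨ρ / 2, by positivity, ?_, ?_⟩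
  · refine Summable.of_nonneg_of_le (fun _ => by positivity) (fun m => ?_)
      ((hF.comp_injective hi).mul_left (2 / ρ))
    have := natCast_mul_pow_pred_le hρ (a := ρ / 2) (by rw [abs_of_pos (by positivity)]) (m.2 + 1)
    have h2 : (ρ / 2) ^ m.1 ≤ ρ ^ m.1 := by gcongr; linarith
    rw [abs_of_nonneg (by positivity), Nat.add_sub_cancel] at this
    rw [c_derivY, abs_mul, abs_of_nonneg (by positivity : (0 : ℝ) ≤ m.2 + 1), pow_add]
    calc _ = |c (m.1, m.2 + 1) F| * (((m.2 + 1 : ℕ) : ℝ) * (ρ / 2) ^ m.2) * (ρ / 2) ^ m.1 := by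
          push_cast; ring
      _ ≤ |c (m.1, m.2 + 1) F| * (2 / ρ * ρ ^ (m.2 + 1)) * ρ ^ m.1 := by gcongr
      _ = _ := by simp only [Function.comp]; ring
  · filter_upwards [hd] with p hp
    have h : HasSum (fun m => termDeriv F p m (0, 1)) (LightLike.dY f p) := by
      rw [LightLike.dY, hp.2.fderiv]
      exact hasSum_apply hp.1 (0, 1)
    rw [← hi.hasSum_iff] at h
    · refine h.congr_fun fun m => ?_
      simp [term, termDeriv]
      ring
    · rintro ⟨j, _ | k⟩ hm
      · simp [termDeriv]
      · exact absurd ⟨(j, k), rfl⟩ hm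

/-- By induction on the degree: up to a nonzero factor, a coefficient of `F` is a coefficient of
lower degree of `derivX F` or `derivY F`, which again represents zero. -/
theorem eq_zero (hf : Represents F f) (h0 : f =ᶠ[𝓝 0] 0) : F = 0 := by
  have key : ∀ n (F : Series), Represents F 0 → ∀ m : ℕ × ℕ, m.1 + m.2 = n → c m F = 0 := by
    have hX : LightLike.dX 0 = 0 := by ext p; simp [LightLike.dX]
    have hY : LightLike.dY 0 = 0 := by ext p; simp [LightLike.dY]
    intro n
    induction n with
    | zero =>
      rintro F hF ⟨j, k⟩ hm
      obtain ⟨rfl, rfl⟩ : j = 0 ∧ k = 0 := by simpa using hm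
      exact hF.apply_zero.symm
    | succ n ih =>
      rintro F hF ⟨_ | j, k⟩ hm
      · obtain ⟨k, rfl⟩ : ∃ k', k = k' + 1 := ⟨n, by simpa using hm⟩
        have := ih (derivY F) (hY ▸ hF.dY) (0, k) (by simp at hm ⊢; omega)
        rw [c_derivY, mul_eq_zero] at this
        exact this.resolve_left (by positivity)
      · have := ih (derivX F) (hX ▸ hF.dX) (j, k) (by simp at hm ⊢; omega)
        rw [c_derivX, mul_eq_zero] at this
        exact this.resolve_left (by positivity)
  exact ext_c fun m => by simpa using key _ F (hf.congr h0) m rfl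

theorem unique (hf : Represents F f) (hg : Represents G g) (h : f =ᶠ[𝓝 0] g) : F = G := by
  refine sub_eq_zero.1 ((hf.sub hg).eq_zero ?_)
  filter_upwards [h] with p hp
  simp [hp]

end Represents

theorem Represents.exists_norm_lt_top {F : Series} {f : Plane → ℝ}
    (hf : Represents F f) : ∃ ρ₀ : ℝ≥0, 0 < ρ₀ ∧ ∀ ρ ≤ ρ₀, norm ρ ρ F < ⊤ := by
  obtain ⟨ρ₀, hρ, hF, -⟩ := hf
  lift ρ₀ to ℝ≥0 using hρ.le
  refine ⟨ρ₀, by exact_mod_cast hρ, fun ρ h => (norm_mono h h F).trans_lt ?_⟩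
  have hF' : Summable fun m : ℕ × ℕ => ‖c m F‖₊ * ρ₀ ^ (m.1 + m.2) := by
    rw [← NNReal.summable_coe]
    exact hF.congr fun m => by simp
  refine lt_of_le_of_lt (ENNReal.tsum_le_tsum fun m => ?_)
    (ENNReal.tsum_coe_ne_top_iff_summable.2 hF').lt_top
  rw [ENNReal.coe_le_coe, weight, pow_add]
  gcongr
  refine div_le_self zero_le ?_
  exact_mod_cast Nat.choose_pos (by omega)

/-- The binomial in the weight is at most `2 ^ (j + k)`, which halving both radii compensates. -/
theorem exists_convergesOn {F : Series} {r s : ℝ≥0} (hr : 0 < r) (hs : 0 < s)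
    (h : norm r s F < ⊤) : ∃ ρ : ℝ, 0 < ρ ∧ ConvergesOn F ρ := by
  have h' := ENNReal.tsum_coe_ne_top_iff_summable.1 h.ne
  refine ⟨(min (r / 2) (s / 2) : ℝ≥0), by positivity, ?_⟩
  rw [← NNReal.summable_coe] at h'
  refine Summable.of_nonneg_of_le (fun _ => by positivity) (fun m => ?_) h'
  rw [NNReal.coe_mul, coe_nnnorm, Real.norm_eq_abs]
  gcongr
  rw [← NNReal.coe_pow, NNReal.coe_le_coe, weight]
  calc (min (r / 2) (s / 2)) ^ (m.1 + m.2) ≤ (r / 2) ^ m.1 * (s / 2) ^ m.2 := by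
        rw [pow_add]
        gcongr
        · exact min_le_left _ _
        · exact min_le_right _ _
    _ = r ^ m.1 * s ^ m.2 / 2 ^ (m.1 + m.2) := by
        rw [div_pow, div_pow, pow_add, div_mul_div_comm]
    _ ≤ _ := by
        gcongr
        · exact_mod_cast Nat.choose_pos (by omega)
        · exact_mod_cast Nat.choose_le_two_pow _ _

/-! ### Analytic functions of two variables as double power series -/

/-- The monomial `x ^ j * y ^ (n - j)` as a continuous multilinear form. -/
noncomputable def monomialForm (n j : ℕ) : ContinuousMultilinearMap ℝ (fun _ : Fin n => Plane) ℝ :=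
  (ContinuousMultilinearMap.mkPiAlgebra ℝ (Fin n) ℝ).compContinuousLinearMap fun i =>
    if (i : ℕ) < j then ContinuousLinearMap.fst ℝ ℝ ℝ else ContinuousLinearMap.snd ℝ ℝ ℝ

theorem norm_monomialForm_le (n j : ℕ) : ‖monomialForm n j‖ ≤ 1 := by
  refine (ContinuousMultilinearMap.norm_compContinuousLinearMap_le _ _).trans ?_
  rw [ContinuousMultilinearMap.norm_mkPiAlgebra, one_mul]
  refine Finset.prod_le_one (fun _ _ => norm_nonneg _) fun i _ => ?_
  split_ifs
  · exact ContinuousLinearMap.norm_fst_le _ _ _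
  · exact ContinuousLinearMap.norm_snd_le _ _ _

theorem monomialForm_apply_const (j k : ℕ) (p : Plane) :
    monomialForm (j + k) j (fun _ => p) = p.1 ^ j * p.2 ^ k := by
  simp only [monomialForm, ContinuousMultilinearMap.compContinuousLinearMap_apply,
    ContinuousMultilinearMap.mkPiAlgebra_apply, Fin.prod_univ_add]
  simp

/-- The formal multilinear series of a double power series. -/
noncomputable def toFormalMultilinearSeries (F : Series) : FormalMultilinearSeries ℝ Plane ℝ :=
  fun n => ∑ m ∈ antidiagonal n, c m F • monomialForm n m.1

theorem toFormalMultilinearSeries_apply_const (F : Series) (n : ℕ) (p : Plane) :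
    toFormalMultilinearSeries F n (fun _ => p) = ∑ m ∈ antidiagonal n, term F p m := by
  rw [toFormalMultilinearSeries, _root_.sum_apply]
  refine Finset.sum_congr rfl fun m hm => ?_
  rw [← mem_antidiagonal.1 hm, _root_.smul_apply, monomialForm_apply_const,
    term, smul_eq_mul, mul_assoc]

theorem Represents.analyticAt {F : Series} {f : Plane → ℝ} (hf : Represents F f) :
    AnalyticAt ℝ f 0 := by
  obtain ⟨ρ, hρ, hF, hf⟩ := hf
  lift ρ to ℝ≥0 using hρ.le
  have hρ' : 0 < ρ := by exact_mod_cast hρ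
  have h : HasFPowerSeriesOnBall (fun p => ∑' m, term F p m) (toFormalMultilinearSeries F) 0 ρ :=
    { r_le := by
        refine FormalMultilinearSeries.le_radius_of_summable _ ?_
        refine Summable.of_nonneg_of_le (fun _ => by positivity) (fun n => ?_)
          (summable_sum_antidiagonal hF)
        refine (mul_le_mul_of_nonneg_right (norm_sum_le _ _) (by positivity)).trans ?_
        rw [Finset.sum_mul]
        refine Finset.sum_le_sum fun m hm => ?_
        rw [mem_antidiagonal.1 hm, norm_smul, Real.norm_eq_abs]
        gcongr
        exact mul_le_of_le_one_right (abs_nonneg _) (norm_monomialForm_le _ _)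
      r_pos := by exact_mod_cast hρ'
      hasSum := fun {p} hp => by
        have hp' : ‖p‖ ≤ ρ := by
          rw [Metric.eball_coe, Metric.mem_ball, dist_zero_right] at hp
          exact hp.le
        simp only [toFormalMultilinearSeries_apply_const, zero_add]
        exact hasSum_sum_antidiagonal (hF.summable_term hp').hasSum }
  refine h.analyticAt.congr ?_
  filter_upwards [hf] with p hp
  exact hp.tsum_eq

/-- The coefficient of `x ^ j * y ^ (n - j)` in the homogeneous polynomial given by a multilinear
form. -/
noncomputable def formCoeff {n : ℕ} (q : ContinuousMultilinearMap ℝ (fun _ : Fin n => Plane) ℝ)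
    (j : ℕ) : ℝ :=
  ∑ s ∈ powersetCard j (univ : Finset (Fin n)),
    q (s.piecewise (fun _ => ((1, 0) : Plane)) fun _ => (0, 1))

theorem abs_formCoeff_le {n : ℕ} (q : ContinuousMultilinearMap ℝ (fun _ : Fin n => Plane) ℝ)
    (j : ℕ) : |formCoeff q j| ≤ 2 ^ n * ‖q‖ := by
  refine (abs_sum_le_sum_abs _ _).trans ((Finset.sum_le_card_nsmul _ _ ‖q‖ fun s _ => ?_).trans ?_)
  · refine (q.le_opNorm _).trans (mul_le_of_le_one_right (norm_nonneg _) ?_)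
    refine Finset.prod_le_one (fun _ _ => norm_nonneg _) fun i _ => ?_
    by_cases hi : i ∈ s <;> simp [hi, Prod.norm_def]
  · rw [card_powersetCard, card_univ, Fintype.card_fin, nsmul_eq_mul]
    gcongr
    exact_mod_cast Nat.choose_le_two_pow _ _

/-- Multilinear expansion at `x e₁ + y e₂`, grouped by the number of slots filled with `e₁`. The
form need not be symmetric, hence the sum over subsets in `formCoeff`. -/
theorem apply_const_eq_sum_formCoeff {n : ℕ}
    (q : ContinuousMultilinearMap ℝ (fun _ : Fin n => Plane) ℝ) (p : Plane) :
    q (fun _ => p) = ∑ m ∈ antidiagonal n, formCoeff q m.1 * p.1 ^ m.1 * p.2 ^ m.2 := by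
  have hp : (fun _ : Fin n => p) =
      (fun _ => p.1 • ((1, 0) : Plane)) + fun _ => p.2 • ((0, 1) : Plane) := by
    ext <;> simp
  have hs : ∀ s : Finset (Fin n), q (s.piecewise (fun _ => p.1 • ((1, 0) : Plane))
      fun _ => p.2 • ((0, 1) : Plane)) = p.1 ^ #s * p.2 ^ (n - #s) *
        q (s.piecewise (fun _ => ((1, 0) : Plane)) fun _ => (0, 1)) := by
    intro s
    have e : (s.piecewise (fun _ => p.1 • ((1, 0) : Plane)) fun _ => p.2 • ((0, 1) : Plane)) =
        fun i => (if i ∈ s then p.1 else p.2) •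
          (s.piecewise (fun _ => ((1, 0) : Plane)) (fun _ => (0, 1)) : Fin n → Plane) i := by
      funext i
      by_cases hi : i ∈ s <;> simp [hi]
    rw [e, q.map_smul_univ, Finset.prod_ite, smul_eq_mul]
    simp [Finset.filter_notMem_eq_sdiff, Finset.card_sdiff]
  rw [hp, q.map_add_univ, ← Finset.powerset_univ, Finset.sum_powerset,
    Finset.Nat.sum_antidiagonal_eq_sum_range_succ_mk, card_univ, Fintype.card_fin]
  refine Finset.sum_congr rfl fun j _ => ?_
  rw [formCoeff, Finset.sum_mul, Finset.sum_mul]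
  refine Finset.sum_congr rfl fun s hs' => ?_
  rw [hs, (mem_powersetCard.1 hs').2]
  ring

theorem exists_represents {f : Plane → ℝ} (hf : AnalyticAt ℝ f 0) :
    ∃ F : Series, Represents F f := by
  obtain ⟨q, r, hq⟩ := hf
  obtain ⟨r', hr'0, hr'⟩ := ENNReal.lt_iff_exists_nnreal_btwn.1 hq.r_pos
  have hr'0 : 0 < r' := by exact_mod_cast hr'0
  -- One factor `2 ^ n` is lost in `abs_formCoeff_le`, another to the `n + 1 ≤ 2 ^ n` monomials of
  -- degree `n`.
  set ρ : ℝ≥0 := r' / 4 with hρ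
  have hρ0 : 0 < ρ := by positivity
  have hsum : Summable fun n => ‖q n‖ * (r' : ℝ) ^ n :=
    q.summable_norm_mul_pow (hr'.trans_le hq.r_le)
  set F : Series := ofCoeff fun m => formCoeff (q (m.1 + m.2)) m.1 with hFdef
  have hF : ConvergesOn F ρ := by
    unfold ConvergesOn
    rw [← Finset.HasAntidiagonal.sigmaAntidiagonalEquivProd.summable_iff,
      summable_sigma_of_nonneg fun _ => by simp only [Function.comp]; positivity]
    refine ⟨fun n => (hasSum_fintype _).summable,
      Summable.of_nonneg_of_le (fun n => tsum_nonneg fun _ => by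
        simp only [Function.comp]; positivity) (fun n => ?_) hsum⟩
    rw [tsum_fintype, Finset.univ_eq_attach]
    refine (Finset.sum_le_card_nsmul _ _ (2 ^ n * ‖q n‖ * (ρ : ℝ) ^ n) fun m _ => ?_).trans ?_
    · have hm := mem_antidiagonal.1 m.2
      change |c m.1 F| * (ρ : ℝ) ^ (m.1.1 + m.1.2) ≤ _
      rw [hFdef, c_ofCoeff, hm]
      gcongr
      exact abs_formCoeff_le _ _
    · rw [card_attach, Finset.Nat.card_antidiagonal, nsmul_eq_mul]
      have h2 : ((n + 1 : ℕ) : ℝ) ≤ 2 ^ n := by exact_mod_cast Nat.lt_two_pow_self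
      calc _ ≤ (2 : ℝ) ^ n * (2 ^ n * ‖q n‖ * (ρ : ℝ) ^ n) := by gcongr
        _ = ‖q n‖ * (2 * 2 * ρ : ℝ) ^ n := by rw [mul_pow, mul_pow]; ring
        _ = _ := by rw [hρ]; push_cast; ring_nf
  refine ⟨F, ρ, by exact_mod_cast hρ0, hF, ?_⟩
  filter_upwards [eventually_norm_le (ρ := (ρ : ℝ)) (by exact_mod_cast hρ0)] with p hp
  have h1 := (hF.summable_term hp).hasSum
  have h2 := hasSum_sum_antidiagonal h1
  have h3 : HasSum (fun n => q n fun _ => p) (f (0 + p)) := hq.hasSum (by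
    refine Metric.eball_subset_eball hr'.le ?_
    rw [Metric.eball_coe, Metric.mem_ball, dist_zero_right]
    refine lt_of_le_of_lt hp ?_
    rw [hρ]
    push_cast
    have : (0 : ℝ) < r' := by exact_mod_cast hr'0
    linarith)
  rw [zero_add] at h3
  have e : (fun n => ∑ m ∈ antidiagonal n, term F p m) = fun n => q n fun _ => p := by
    funext n
    rw [apply_const_eq_sum_formCoeff]
    refine Finset.sum_congr rfl fun m hm => ?_
    rw [term, hFdef, c_ofCoeff, mem_antidiagonal.1 hm]
  rw [e] at h2
  rwa [h2.unique h3] at h1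

end Series

end DoubleSeries

/-! ### The Cauchy problem for analytic functions. -/

namespace Series

variable {F : Series} {f : Plane → ℝ}

theorem Represents.funA (hf : Represents F f) : Represents (formalA F) (funA f) := by
  have hX := hf.dX
  have hY := hf.dY
  have h2 : Represents 2 (1 + 1) := by
    rw [← one_add_one_eq_two]
    exact Represents.one.add .one
  refine ((((Represents.one.sub hX.pow_two).mul hY.dY).add
    (((h2.mul hX).mul hY).mul hX.dY)).add ((Represents.one.sub hY.pow_two).mul hX.dX)).congr ?_
  refine Eventually.of_forall fun p => ?_
  simp only [LightLike.funA, Pi.add_apply, Pi.sub_apply, Pi.mul_apply, Pi.pow_apply, Pi.one_apply]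
  ring

theorem Represents.funB (hf : Represents F f) : Represents (formalB F) (funB f) :=
  (Represents.one.sub hf.dX.pow_two).sub hf.dY.pow_two

theorem Represents.eventually_norm_lt_top (hf : Represents F f) :
    ∀ᶠ ρ in 𝓝[>] (0 : ℝ≥0), norm ρ ρ F < ⊤ := by
  obtain ⟨ρ₀, h0, h⟩ := hf.exists_norm_lt_top
  filter_upwards [nhdsWithin_le_nhds (Iic_mem_nhds h0)] with ρ hρ
  exact h ρ hρ

theorem eventually_norm_le_coe {r s : ℝ≥0} (h : norm r s F < ⊤) :
    ∀ᶠ K : ℝ≥0 in atTop, norm r s F ≤ K := by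
  filter_upwards [eventually_ge_atTop (norm r s F).toNNReal] with K hK
  rw [← ENNReal.coe_toNNReal h.ne]
  exact ENNReal.coe_le_coe.2 hK

end Series

open Series

theorem tendsto_xAxis : Tendsto (fun x : ℝ => ((x, 0) : Plane)) (𝓝 0) (𝓝 0) := by
  have hc : Continuous (fun x : ℝ => ((x, 0) : Plane)) := by fun_prop
  exact hc.tendsto' 0 0 rfl

theorem tendsto_fst_zero : Tendsto (fun p : Plane => p.1) (𝓝 0) (𝓝 0) :=
  continuous_fst.tendsto' 0 0 rfl

theorem deriv_xAxis {f : Plane → ℝ} (hf : DifferentiableAt ℝ f 0) :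
    HasDerivAt (fun x => f (x, 0)) (dX f 0) 0 := by
  have h : HasDerivAt (fun x : ℝ => ((x, 0) : Plane)) (1, 0) 0 :=
    (hasDerivAt_id (0 : ℝ)).prodMk (hasDerivAt_const 0 0)
  exact HasFDerivAt.comp_hasDerivAt (0 : ℝ) (f := fun x : ℝ => ((x, 0) : Plane))
    (l := f) (l' := fderiv ℝ f 0) hf.hasFDerivAt h

theorem analyticAt_dX {f : Plane → ℝ} (hf : AnalyticAt ℝ f 0) : AnalyticAt ℝ (dX f) 0 := by
  obtain ⟨F, hF⟩ := exists_represents hf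
  exact hF.dX.analyticAt

theorem analyticAt_dY {f : Plane → ℝ} (hf : AnalyticAt ℝ f 0) : AnalyticAt ℝ (dY f) 0 := by
  obtain ⟨F, hF⟩ := exists_represents hf
  exact hF.dY.analyticAt

/-- Existence for the Cauchy problem of `A = φ B ^ 2`. -/
theorem exists_solution {u : Plane → ℝ} (hu : AnalyticAt ℝ u 0) {γ : ℝ → ℝ × ℝ}
    (hγ : AnalyticAt ℝ γ 0) (h0 : γ 0 = (0, 1)) (h1 : (deriv γ 0).1 = 0) :
    ∃ f : Plane → ℝ, AnalyticAt ℝ f 0 ∧ (∀ᶠ p in 𝓝 0, funA f p - u p * funB f p ^ 2 = 0) ∧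
      (∀ᶠ x in 𝓝 (0 : ℝ), (f (x, 0), dY f (x, 0)) = γ x) ∧ dX f 0 = 0 := by
  obtain ⟨Φ, hΦ⟩ := exists_represents hu
  have hγ' : AnalyticAt ℝ (fun p : Plane => γ p.1) 0 :=
    AnalyticAt.fun_comp (f := fun p : Plane => p.1) hγ analyticAt_fst
  have hγ₁ : AnalyticAt ℝ (fun p : Plane => (γ p.1).1) 0 := analyticAt_fst.comp hγ'
  have hγ₂ : AnalyticAt ℝ (fun p : Plane => (γ p.1).2) 0 := analyticAt_snd.comp hγ'
  obtain ⟨U₁, hU₁⟩ := exists_represents hγ₁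
  obtain ⟨U₂, hU₂⟩ := exists_represents hγ₂
  -- The represented function depends on `x` only, so uniqueness of the series makes it constant in
  -- `y`.
  have e₁ : restrictX U₁ = U₁ := hU₁.restrictX.unique hU₁ (EventuallyEq.refl _ _)
  have e₂ : restrictX U₂ = U₂ := hU₂.restrictX.unique hU₂ (EventuallyEq.refl _ _)
  have hX : dX (fun p : Plane => (γ p.1).1) 0 = 0 := by
    have ha := deriv_xAxis hγ₁.differentiableAt
    have hb : HasDerivAt (fun x => (γ x).1) (deriv γ 0).1 0 :=
      hγ.differentiableAt.hasDerivAt.fst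
    rw [ha.unique hb, h1]
  have v₁ : VanishesTo 1 (derivX U₁) := vanishesTo_one_iff.2 (by rw [← hU₁.dX.apply_zero, hX])
  have v₂ : VanishesTo 1 (1 - U₂) := vanishesTo_one_iff.2 (by
    rw [← (Represents.one.sub hU₂).apply_zero]
    simp [h0])
  -- One radius, and then one bound `K`, valid for all seven series.
  obtain ⟨ρ, hρ, hρ0⟩ := ((hΦ.eventually_norm_lt_top.and (hU₁.eventually_norm_lt_top.and
    (hU₁.dX.eventually_norm_lt_top.and (hU₁.dX.dX.eventually_norm_lt_top.and
    (hU₂.eventually_norm_lt_top.and (hU₂.dX.eventually_norm_lt_top.and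
    hU₂.dX.dX.eventually_norm_lt_top)))))).and self_mem_nhdsWithin).exists
  obtain ⟨n1, n2, n3, n4, n5, n6, n7⟩ := hρ
  obtain ⟨K, k1, k2, k3, k4, k5, k6, k7⟩ := ((eventually_norm_le_coe n1).and
    ((eventually_norm_le_coe n2).and ((eventually_norm_le_coe n3).and
    ((eventually_norm_le_coe n4).and ((eventually_norm_le_coe n5).and
    ((eventually_norm_le_coe n6).and (eventually_norm_le_coe n7))))))).exists
  obtain ⟨F, hF₁, hF₂, hFA, r, s, hr, hs, hFn⟩ :=
    exists_convergent_solution e₁ e₂ v₁ v₂ hρ0 k1 k2 k3 k4 k5 k6 k7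
  obtain ⟨δ, hδ, hFδ⟩ := exists_convergesOn hr hs hFn
  have hf := hFδ.represents hδ
  set f : Plane → ℝ := fun p => ∑' m, term F p m
  refine ⟨f, hf.analyticAt, ?_, ?_, ?_⟩
  · have := hf.funA.sub (hΦ.mul hf.funB.pow_two)
    rw [hFA] at this
    filter_upwards [this.eventuallyEq .zero] with p hp
    simpa using hp
  · have a₁ := (hF₁ ▸ hf.restrictX).eventuallyEq hU₁
    have a₂ := (hF₂ ▸ hf.dY.restrictX).eventuallyEq hU₂
    filter_upwards [tendsto_xAxis.eventually a₁, tendsto_xAxis.eventually a₂] with x h1 h2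
    exact Prod.ext h1 h2
  · have a : c (1, 0) (restrictX F) = c (1, 0) U₁ := by rw [hF₁]
    have b := hU₁.dX.apply_zero
    rw [hf.dX.apply_zero]
    rw [hX] at b
    simp at a b ⊢
    rw [a, ← b]

/-- Uniqueness for the Cauchy problem of `A = φ B ^ 2`. -/
theorem eventuallyEq_of_solution {u f g : Plane → ℝ} (hu : AnalyticAt ℝ u 0)
    (hf : AnalyticAt ℝ f 0) (hg : AnalyticAt ℝ g 0)
    (hfA : ∀ᶠ p in 𝓝 0, funA f p - u p * funB f p ^ 2 = 0)
    (hgA : ∀ᶠ p in 𝓝 0, funA g p - u p * funB g p ^ 2 = 0)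
    (hX : dX f 0 = 0) (hY : dY f 0 = 1)
    (h : ∀ᶠ x in 𝓝 (0 : ℝ), (f (x, 0), dY f (x, 0)) = (g (x, 0), dY g (x, 0))) :
    f =ᶠ[𝓝 0] g := by
  obtain ⟨Φ, hΦ⟩ := exists_represents hu
  obtain ⟨F, hF⟩ := exists_represents hf
  obtain ⟨G, hG⟩ := exists_represents hg
  have h' := tendsto_fst_zero.eventually h
  have key : F = G := by
    refine eq_of_formal_solution (φ := Φ) ?_ ?_ (hF.restrictX.unique hG.restrictX ?_)
      (hF.dY.restrictX.unique hG.dY.restrictX ?_)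
      ((hF.funA.sub (hΦ.mul hF.funB.pow_two)).eq_zero hfA)
      ((hG.funA.sub (hΦ.mul hG.funB.pow_two)).eq_zero hgA)
    · have := hF.dX.apply_zero
      rw [hX] at this
      simpa using this.symm
    · have := hF.dY.apply_zero
      rw [hY] at this
      simpa using this.symm
    · filter_upwards [h'] with p hp
      exact congrArg Prod.fst hp
    · filter_upwards [h'] with p hp
      exact congrArg Prod.snd hp
  subst key
  exact hF.eventuallyEq hG

/-! ### Normalized graphs and the gradient of `B`. -/

/-- The graph of a function as a map into the Lorentz-Minkowski space. -/
def graphMap (f : Plane → ℝ) : Plane → L3 := fun p => (f p, p.1, p.2)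

theorem fderiv_eq_smul_add_smul (f : Plane → ℝ) (p v : Plane) :
    fderiv ℝ f p v = v.1 * dX f p + v.2 * dY f p := by
  have : v = v.1 • ((1, 0) : Plane) + v.2 • ((0, 1) : Plane) := by ext <;> simp
  conv_lhs => rw [this]
  rw [map_add, map_smul, map_smul]
  rfl

theorem fderiv_graphMap {f : Plane → ℝ} {p : Plane} (hf : DifferentiableAt ℝ f p) (v : Plane) :
    fderiv ℝ (graphMap f) p v = (v.1 * dX f p + v.2 * dY f p, v.1, v.2) := by
  have h : HasFDerivAt (graphMap f)
      ((fderiv ℝ f p).prod (ContinuousLinearMap.id ℝ Plane)) p :=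
    hf.hasFDerivAt.prodMk (hasFDerivAt_id p)
  rw [h.fderiv, ← fderiv_eq_smul_add_smul]
  rfl

theorem isNormalized_graphMap {f : Plane → ℝ} (hf : AnalyticAt ℝ f 0) (h0 : f 0 = 0)
    (hX : dX f 0 = 0) (hY : dY f 0 = 1) : IsNormalized (graphMap f) where
  analytic := hf.prod analyticAt_id
  map_zero := by simp [graphMap, h0]
  immersion := fun v w h => by
    rw [fderiv_graphMap hf.differentiableAt, fderiv_graphMap hf.differentiableAt] at h
    exact congrArg Prod.snd h
  lightLike := by
    -- This vector is `(1, 0, 1)`, null and orthogonal to the other tangent direction `(0, 1, 0)`.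
    refine ⟨fderiv ℝ (graphMap f) 0 (0, 1), ⟨(0, 1), rfl⟩, ?_, ?_⟩
    · rw [fderiv_graphMap hf.differentiableAt]
      simp
    · rintro _ ⟨w, rfl⟩
      change lorentzInner _ (fderiv ℝ (graphMap f) 0 w) = 0
      rw [fderiv_graphMap hf.differentiableAt, fderiv_graphMap hf.differentiableAt]
      simp [lorentzInner, hX, hY]
  graph := Eventually.of_forall fun _ => rfl
  normX := hX
  normY := hY

theorem IsNormalized.height_analyticAt {F : Plane → L3} (hF : IsNormalized F) :
    AnalyticAt ℝ (height F) 0 :=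
  analyticAt_fst.comp hF.analytic

theorem IsNormalized.hasDerivAt_initialCurve {F : Plane → L3} (hF : IsNormalized F) :
    HasDerivAt (initialCurve F) (0, dX (dY (height F)) 0) 0 := by
  have ha := hF.height_analyticAt
  have h1 := deriv_xAxis ha.differentiableAt
  rw [hF.normX] at h1
  exact h1.prodMk (deriv_xAxis (analyticAt_dY ha).differentiableAt)

theorem IsNormalized.initialCurve_analyticAt {F : Plane → L3} (hF : IsNormalized F) :
    AnalyticAt ℝ (initialCurve F) 0 := by
  have ha := hF.height_analyticAt
  have hx : AnalyticAt ℝ (fun x : ℝ => ((x, 0) : Plane)) 0 := analyticAt_id.prod analyticAt_const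
  exact (AnalyticAt.comp (f := fun x : ℝ => ((x, 0) : Plane)) (g := height F) ha hx).prod
    (AnalyticAt.comp (f := fun x : ℝ => ((x, 0) : Plane)) (g := dY (height F))
      (analyticAt_dY ha) hx)

theorem IsNormalized.initialCurve_zero {F : Plane → L3} (hF : IsNormalized F) :
    initialCurve F 0 = (0, 1) := by
  have h : height F (0, 0) = 0 := congrArg Prod.fst hF.map_zero
  exact Prod.ext h hF.normY

theorem IsNormalized.gradB_eq {F : Plane → L3} (hF : IsNormalized F) :
    gradB F = (-2 * dX (dY (height F)) 0, -2 * dY (dY (height F)) 0) := by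
  have hX := (analyticAt_dX hF.height_analyticAt).differentiableAt.hasFDerivAt
  have hY := (analyticAt_dY hF.height_analyticAt).differentiableAt.hasFDerivAt
  have hB : HasFDerivAt (funB (height F)) _ 0 := ((hX.pow 2).const_sub 1).sub (hY.pow 2)
  have hB' := hB.fderiv
  ext
  · simp only [gradB]
    rw [dX, hB']
    simp [hF.normX, hF.normY]
    rfl
  · simp only [gradB]
    rw [dY, hB']
    simp [hF.normX, hF.normY]
    rfl

/-- At `o` the coefficients of `f_xy` and `f_xx` vanish, as does `B`, and that of `f_yy` is `1`.
Hence `f_xy` alone decides degeneracy. -/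
theorem IsNormalized.dY_dY_eq_zero {F : Plane → L3} (hF : IsNormalized F) {u : Plane → ℝ}
    (h : funA (height F) 0 - u 0 * funB (height F) 0 ^ 2 = 0) : dY (dY (height F)) 0 = 0 := by
  simpa [funA, funB, hF.normX, hF.normY] using h

theorem gradB_congr {F G : Plane → L3} (h : F =ᶠ[𝓝 0] G) : gradB F = gradB G := by
  have h1 : height F =ᶠ[𝓝 0] height G := h.mono fun p hp => congrArg Prod.fst hp
  have h2 : funB (height F) =ᶠ[𝓝 0] funB (height G) := by
    filter_upwards [h1.fderiv (𝕜 := ℝ)] with p hp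
    simp only [funB, dX, dY, hp]
  simp only [gradB, dX, dY, h2.fderiv_eq]

theorem isLightLikeAt_congr {F G : Plane → L3} (h : F =ᶠ[𝓝 0] G) :
    IsLightLikeAt F 0 ↔ IsLightLikeAt G 0 := by
  simp only [IsLightLikeAt, h.fderiv_eq]

/-! ### The bijection with initial curves and the degeneracy criterion. -/

section AdmissibleGerms

variable {u : Plane → ℝ}

theorem mem_admissibleGerms_iff {G : Germ (𝓝 (0 : Plane)) L3} :
    G ∈ admissibleGerms (u : Germ (𝓝 (0 : Plane)) ℝ) ↔
      ∃ F : Plane → L3, IsNormalized F ∧ (F : Germ (𝓝 (0 : Plane)) L3) = G ∧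
        ∀ᶠ p in 𝓝 0, funA (height F) p - u p * funB (height F) p ^ 2 = 0 := by
  refine exists_congr fun F => and_congr_right fun _ => and_congr_right fun _ => ?_
  exact Germ.coe_eq (f := fun p => funA (height F) p - u p * funB (height F) p ^ 2)
    (g := fun _ => 0)

theorem bijOn_admissibleGerms (hu : AnalyticAt ℝ u 0) :
    Set.BijOn initialCurveGerm (admissibleGerms (u : Germ (𝓝 (0 : Plane)) ℝ))
      initialCurveGerms := by
  refine ⟨fun G hG => ?_, fun G hG G' hG' h => ?_, ?_⟩
  · obtain ⟨F, hF, rfl, -⟩ := mem_admissibleGerms_iff.1 hG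
    exact ⟨initialCurve F, hF.initialCurve_analyticAt, hF.initialCurve_zero,
      by rw [hF.hasDerivAt_initialCurve.deriv], rfl⟩
  · obtain ⟨F, hF, rfl, hA⟩ := mem_admissibleGerms_iff.1 hG
    obtain ⟨F', hF', rfl, hA'⟩ := mem_admissibleGerms_iff.1 hG'
    have h' : initialCurve F =ᶠ[𝓝 0] initialCurve F' := Germ.coe_eq.1 h
    have key := eventuallyEq_of_solution hu hF.height_analyticAt hF'.height_analyticAt hA hA'
      hF.normX hF.normY h'
    refine Germ.coe_eq.2 ?_
    -- Near `o` both maps are graphs of their heights, so equal heights give equal germs.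
    filter_upwards [hF.graph, hF'.graph, key] with p h1 h2 h3
    rw [h1, h2, h3]
  · rintro _ ⟨γ, hγ, h0, h1, rfl⟩
    obtain ⟨f, hf, hA, hi, hX⟩ := exists_solution hu hγ h0 h1
    have hi0 := hi.self_of_nhds
    rw [h0] at hi0
    exact ⟨(graphMap f : Plane → L3), mem_admissibleGerms_iff.2 ⟨graphMap f,
      isNormalized_graphMap hf (congrArg Prod.fst hi0) hX (congrArg Prod.snd hi0), rfl, hA⟩,
      Germ.coe_eq.2 hi⟩

theorem initialCurveGerms_nonempty : initialCurveGerms.Nonempty :=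
  ⟨_, fun _ => (0, 1), analyticAt_const, rfl, by simp, rfl⟩

theorem isLightLikeAt_and_gradB_eq_zero_iff {F : Plane → L3}
    (hF : (F : Germ (𝓝 (0 : Plane)) L3) ∈ admissibleGerms (u : Germ (𝓝 (0 : Plane)) ℝ)) :
    IsLightLikeAt F 0 ∧ (gradB F = (0, 0) ↔ deriv (initialCurve F) 0 = (0, 0)) := by
  obtain ⟨G, hG, hGF, hA⟩ := mem_admissibleGerms_iff.1 hF
  have h : F =ᶠ[𝓝 0] G := (Germ.coe_eq.1 hGF).symm
  -- Membership only provides some normalized representative `G`; each property depends on the germ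
  -- alone, so it is checked on `G`.
  rw [isLightLikeAt_congr h, gradB_congr h, (initialCurve_congr h).deriv_eq,
    hG.hasDerivAt_initialCurve.deriv, hG.gradB_eq, hG.dY_dY_eq_zero hA.self_of_nhds]
  exact ⟨hG.lightLike, by simp⟩

end AdmissibleGerms

theorem zmcGerms_eq_admissibleGerms :
    zmcGerms = admissibleGerms ((fun _ => 0 : Plane → ℝ) : Germ (𝓝 (0 : Plane)) ℝ) := by
  ext G
  refine exists_congr fun F => and_congr_right fun _ => and_congr_right fun _ => ?_
  have : ((fun _ => 0 : Plane → ℝ) : Germ (𝓝 (0 : Plane)) ℝ) = 0 := rfl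
  rw [this, zero_mul, sub_zero]

end LightLike

theorem theorem2p2 (φ : Filter.Germ (nhds (0 : LightLike.Plane)) ℝ)
    (hφ : φ ∈ LightLike.analyticFunctionGerms) :
    (LightLike.admissibleGerms φ).Nonempty ∧
    Set.BijOn LightLike.initialCurveGerm
      (LightLike.admissibleGerms φ) LightLike.initialCurveGerms ∧
    (∀ F : LightLike.Plane → LightLike.L3,
      (F : Filter.Germ (nhds (0 : LightLike.Plane)) LightLike.L3) ∈ LightLike.admissibleGerms φ →
        (LightLike.IsNondegenerateLightLike F ↔ deriv (LightLike.initialCurve F) 0 ≠ (0, 0)) ∧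
        (LightLike.IsDegenerateLightLike F ↔ deriv (LightLike.initialCurve F) 0 = (0, 0))) ∧
    Set.BijOn LightLike.initialCurveGerm LightLike.zmcGerms LightLike.initialCurveGerms := by
  obtain ⟨u, hu, rfl⟩ := hφ
  have hb := LightLike.bijOn_admissibleGerms hu
  refine ⟨?_, hb, fun F hF => ?_, ?_⟩
  · obtain ⟨c, hc⟩ := LightLike.initialCurveGerms_nonempty
    obtain ⟨G, hG, -⟩ := hb.surjOn hc
    exact ⟨G, hG⟩
  · obtain ⟨h1, h2⟩ := LightLike.isLightLikeAt_and_gradB_eq_zero_iff hF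
    exact ⟨⟨fun h => (not_congr h2).1 h.2, fun h => ⟨h1, (not_congr h2).2 h⟩⟩,
      ⟨fun h => h2.1 h.2, fun h => ⟨h1, h2.2 h⟩⟩⟩
  · rw [LightLike.zmcGerms_eq_admissibleGerms]
    exact LightLike.bijOn_admissibleGerms analyticAt_const
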